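/- Let $\mathcal H$ be a complex separable Hilbert space and let $H$ be a (possibly unbounded) self-adjoint operator on $\mathcal H$ with pure point spectrum, i.e. the eigenvectors of $H$ span a dense subspace of $\mathcal H$. Let $\{h_k\}_{k\ge1}$ be its distinct eigenvalues, and assume that the minimal spectral gap is nonvanishing, $$\eta=\inf_{k\neq \ell}|h_k-h_\ell|>0$$ (with $\eta=+\infty$ if there are no two distinct eigenvalues). For every $\varepsilon\in[0,1]$ let $V(\varepsilon)$ be a bounded self-adjoint operator on $\mathcal H$, with $$v=\sup_{\varepsilon\in[0,1]}\|V(\varepsilon)\|<+\infty ,$$ no regularity in $\varepsilon$ being assumed, and let $H(\varepsilon)=H+\varepsilon V(\varepsilon)$ with domain $D(H(\varepsilon))=D(H)$. Let $P_H(\Omega)$, for $\Omega\subseteq\mathbb R$ measurable, be the spectral projections of $H$, that is, $P_H(\Omega)$ is the orthogonal projection onto the closed span of the eigenvectors with eigenvalue in $\Omega$. Define the commutant and the bicommutant of $H$ by $$\{H\}'=\{B\in B(\mathcal H):[B,P_H(\Omega)]=0\ \text{for all measurable }\Omega\subseteq\mathbb R\},$$ $$\{H\}''=\{A\in B(\mathcal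 H):[A,B]=0\ \text{for all }B\in\{H\}'\}.$$ Let $\alpha$ be the unique positive solution of $(\alpha+1)(e^{2/\alpha}-1)=3$ and set $$\beta=\frac{16\pi\alpha}{\sqrt3}\left(e^{\frac1{2\alpha}}-1\right),\qquad \rho=\frac{4\pi\alpha}{\sqrt3}.$$ Then $15.25<\beta<15.3$ and $34.75<\rho<34.8$. Moreover, for every $S\in\{H\}''$ and every $\varepsilon\in[0,1]$ with $\varepsilon\le\frac{\eta}{v\rho}$ (a condition that is void if $v=0$ or $\eta=+\infty$), $H(\varepsilon)$ generates a strongly continuous one-parameter unitary group $t\mapsto e^{-itH(\varepsilon)}$, and the wandering range of $S$ is bounded in operator norm by $$\sup_{t\in\mathbb R}\left\|e^{itH(\varepsilon)}Se^{-itH(\varepsilon)}-S\right\|\le\beta\,\frac{v}{\eta}\,\|S\|\,\varepsilon ,$$ where $v/\eta=0$ if $\eta=+\infty$. -/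

import Mathlib

open scoped ENNReal

/-! ### Unbounded operators and the unitary group they generate -/

section UnitaryGroup

variable {E : Type*} [NormedAddCommGroup E] [InnerProductSpace ℂ E] [CompleteSpace E]

/-- `U` is the strongly continuous one-parameter unitary group `U t = exp (-i t A)` whose
generator is the (possibly unbounded) operator `A`: a vector `ψ` lies in the domain of `A` with
`A ψ = φ` if and only if `t ↦ U t ψ` is differentiable at `0` with derivative `-i φ`. -/
structure IsUnitaryGroupGeneratedBy (U : ℝ → E →L[ℂ] E) (A : E →ₗ.[ℂ] E) : Prop where
  mem_unitary : ∀ t, U t ∈ unitary (E →L[ℂ] E)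
  map_zero : U 0 = 1
  map_add : ∀ s t, U (s + t) = U s * U t
  continuous_apply : ∀ ψ : E, Continuous fun t => U t ψ
  generator : ∀ ψ φ : E,
    (ψ, φ) ∈ A.graph ↔ HasDerivAt (fun t : ℝ => U t ψ) (-(Complex.I • φ)) 0


/-- A group generated by `A` maps the domain of `A` to itself, commutes with `A` there, and solves
the Schrödinger equation. -/
theorem IsUnitaryGroupGeneratedBy.hasDerivAt {U : ℝ → E →L[ℂ] E} {A : E →ₗ.[ℂ] E}
    (hU : IsUnitaryGroupGeneratedBy U A) {ψ φ : E} (h : (ψ, φ) ∈ A.graph) (t : ℝ) :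
    (U t ψ, U t φ) ∈ A.graph ∧
      HasDerivAt (fun s : ℝ => U s ψ) (-(Complex.I • U t φ)) t := by
  have h0 := (hU.generator ψ φ).1 h
  have h1 : HasDerivAt (fun s : ℝ => U t (U s ψ)) (-(Complex.I • U t φ)) 0 := by
    have h2 := ((U t).restrictScalars ℝ).hasFDerivAt.comp_hasDerivAt (0 : ℝ) h0
    simpa [Function.comp_def] using h2
  refine ⟨(hU.generator _ _).2 ?_, ?_⟩
  · refine h1.congr_of_eventuallyEq (Filter.Eventually.of_forall fun s => ?_)
    change U s (U t ψ) = U t (U s ψ)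
    rw [← mul_apply_eq_comp, ← mul_apply_eq_comp, ← hU.map_add,
      ← hU.map_add, add_comm]
  · have h3 : HasDerivAt (fun s : ℝ => U t (U s ψ)) (-(Complex.I • U t φ)) (t - t) := by
      simpa using h1
    have h4 := h3.comp_sub_const t t
    refine h4.congr_of_eventuallyEq (Filter.Eventually.of_forall fun s => ?_)
    change U s ψ = U t (U (s - t) ψ)
    rw [← mul_apply_eq_comp, ← hU.map_add]
    congr 2
    ring

/-- A self-adjoint operator generates at most one unitary group. -/
theorem IsUnitaryGroupGeneratedBy.unique {U W : ℝ → E →L[ℂ] E} {A : E →ₗ.[ℂ] E}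
    (hA : IsSelfAdjoint A) (hU : IsUnitaryGroupGeneratedBy U A)
    (hW : IsUnitaryGroupGeneratedBy W A) : U = W := by
  have hdense : Dense (A.domain : Set E) := hA.dense_domain
  have hsymm : ∀ {x y x' y' : E}, (x, x') ∈ A.graph → (y, y') ∈ A.graph →
      inner ℂ x' y = inner ℂ x y' := by
    intro x y x' y' hx hy
    obtain ⟨a, rfl, rfl⟩ := LinearPMap.mem_graph_iff _ |>.1 hx
    obtain ⟨b, rfl, rfl⟩ := LinearPMap.mem_graph_iff _ |>.1 hy
    have hfa := A.adjoint_isFormalAdjoint hdense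
    rw [LinearPMap.isSelfAdjoint_def.1 hA] at hfa
    exact hfa a b
  funext t
  have key : ∀ x ∈ A.domain, ∀ y ∈ A.domain, inner ℂ (U t x) (W t y) = inner ℂ x y := by
    intro x hx y hy
    have gx : (x, A ⟨x, hx⟩) ∈ A.graph := A.mem_graph ⟨x, hx⟩
    have gy : (y, A ⟨y, hy⟩) ∈ A.graph := A.mem_graph ⟨y, hy⟩
    have hd : ∀ s : ℝ, HasDerivAt (fun s : ℝ => inner ℂ (U s x) (W s y)) 0 s := by
      intro s
      obtain ⟨g1, d1⟩ := hU.hasDerivAt gx s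
      obtain ⟨g2, d2⟩ := hW.hasDerivAt gy s
      have d := d1.inner ℂ d2
      refine d.congr_deriv ?_
      rw [inner_neg_left, inner_neg_right, inner_smul_left, inner_smul_right, hsymm g1 g2]
      simp
    have hc := is_const_of_deriv_eq_zero (fun s => (hd s).differentiableAt)
      (fun s => (hd s).deriv) t 0
    simpa [hU.map_zero, hW.map_zero] using hc
  have key2 : ∀ x ∈ A.domain, ∀ y ∈ A.domain, inner ℂ x (star (U t) (W t y)) = inner ℂ x y := by
    intro x hx y hy
    rw [ContinuousLinearMap.star_eq_adjoint, ContinuousLinearMap.adjoint_inner_right]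
    exact key x hx y hy
  have key3 : star (U t) * W t = 1 := by
    refine ContinuousLinearMap.ext fun z => ?_
    refine congrFun (Continuous.ext_on hdense (ContinuousLinearMap.continuous _)
      (ContinuousLinearMap.continuous _) fun y hy => ?_) z
    exact hdense.eq_of_inner_right ℂ fun x hx => key2 x hx y hy
  calc U t = U t * (star (U t) * W t) := by rw [key3, mul_one]
    _ = W t := by rw [← mul_assoc, (Unitary.mem_iff.1 (hU.mem_unitary t)).2, one_mul]

open Classical in
/-- The unitary group `t ↦ exp (-i t A)` generated by `A`; the zero map if `A` generates none. -/
noncomputable def unitaryGroup (A : E →ₗ.[ℂ] E) : ℝ → E →L[ℂ] E :=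
  if h : ∃ U : ℝ → E →L[ℂ] E, IsUnitaryGroupGeneratedBy U A then h.choose else 0

/-- The perturbed operator `H(ε) = H + ε V(ε)`, with the same domain as `H`. -/
noncomputable def perturbed (H : E →ₗ.[ℂ] E) (V : ℝ → E →L[ℂ] E) (ε : ℝ) : E →ₗ.[ℂ] E :=
  ((ε : ℂ) • V ε).toLinearMap +ᵥ H

/-- The wandering range of `S` under `A` in operator norm: the supremum over all times `t` of
`‖exp (i t A) S exp (-i t A) - S‖`, as an extended nonnegative real. -/
noncomputable def wanderingRange (A : E →ₗ.[ℂ] E) (S : E →L[ℂ] E) : ℝ≥0∞ :=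
  ⨆ t : ℝ, ‖unitaryGroup A (-t) * S * unitaryGroup A t - S‖ₑ

end UnitaryGroup

/-! ### Pure point spectrum, spectral projections, commutant and bicommutant -/

section PurePoint

variable {E : Type*} [NormedAddCommGroup E] [InnerProductSpace ℂ E]

/-- The eigenspace of the operator `A` at `μ`: the vectors `ψ` in the domain of `A` with
`A ψ = μ ψ`. -/
def opEigenspace (A : E →ₗ.[ℂ] E) (μ : ℝ) : Submodule ℂ E :=
  A.graph.comap (LinearMap.prod LinearMap.id ((μ : ℂ) • LinearMap.id))

theorem mem_opEigenspace {A : E →ₗ.[ℂ] E} {μ : ℝ} {ψ : E} :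
    ψ ∈ opEigenspace A μ ↔ ∃ h : ψ ∈ A.domain, A ⟨ψ, h⟩ = (μ : ℂ) • ψ := by
  change (ψ, (μ : ℂ) • ψ) ∈ A.graph ↔ _
  rw [LinearPMap.mem_graph_iff]
  constructor
  · rintro ⟨y, rfl, h⟩
    exact ⟨y.2, h⟩
  · rintro ⟨h, h'⟩
    exact ⟨⟨ψ, h⟩, rfl, h'⟩

/-- The set of eigenvalues of `A` (real, since only self-adjoint operators are considered). -/
def pointSpectrum (A : E →ₗ.[ℂ] E) : Set ℝ := {μ | opEigenspace A μ ≠ ⊥}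

/-- `A` has pure point spectrum: its eigenvectors span a dense subspace (for a self-adjoint `A`,
equivalently, there is an orthonormal basis of eigenvectors). -/
def HasPurePointSpectrum (A : E →ₗ.[ℂ] E) : Prop :=
  (⨆ μ : ℝ, opEigenspace A μ).topologicalClosure = ⊤

/-- The minimal spectral gap: the infimum of `|h - h'|` over pairs of distinct eigenvalues
(`∞` if there is no such pair). -/
noncomputable def minimalSpectralGap (A : E →ₗ.[ℂ] E) : ℝ≥0∞ :=
  (pointSpectrum A).einfsep

variable [CompleteSpace E]

/-- The projection-valued measure `Ω ↦ P_A(Ω)` of a self-adjoint operator `A` with pure point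
spectrum: `P_A(Ω)` is the orthogonal projection onto the closed span of the eigenspaces whose
eigenvalue lies in `Ω`. -/
noncomputable def pointSpectralProjection (A : E →ₗ.[ℂ] E) (Ω : Set ℝ) : E →L[ℂ] E :=
  (⨆ μ ∈ Ω, opEigenspace A μ).topologicalClosure.starProjection

/-- The commutant `{A}'` of a self-adjoint operator `A` with pure point spectrum: the bounded
operators that commute with all its spectral projections. -/
def opCommutant (A : E →ₗ.[ℂ] E) : Set (E →L[ℂ] E) :=
  {S | ∀ Ω : Set ℝ, MeasurableSet Ω → Commute S (pointSpectralProjection A Ω)}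

/-- The bicommutant `{A}''`: the bounded operators that commute with all of `{A}'`. -/
def opBicommutant (A : E →ₗ.[ℂ] E) : Set (E →L[ℂ] E) :=
  {S | ∀ B ∈ opCommutant A, Commute S B}

end PurePoint

/-! ### The constants -/

theorem existsUnique_alpha :
    ∃! a : ℝ, 0 < a ∧ (a + 1) * (Real.exp (2 / a) - 1) = 3 := by
  set g : ℝ → ℝ := fun a => (a + 1) * (Real.exp (2 / a) - 1) with hg
  have hder : ∀ a : ℝ, 0 < a → HasDerivAt g
      (1 * (Real.exp (2 / a) - 1) + (a + 1) * (Real.exp (2 / a) * (-2 / a ^ 2))) a := by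
    intro a ha
    have h1 : HasDerivAt (fun a : ℝ => 2 / a) (-2 / a ^ 2) a := by
      have := (hasDerivAt_inv ha.ne').const_mul 2
      simp only [div_eq_mul_inv]
      refine this.congr_deriv ?_
      field_simp
    exact ((hasDerivAt_id a).add_const 1).mul ((h1.exp).sub_const 1)
  have hcont : ContinuousOn g (Set.Ioi 0) := fun a ha =>
    (hder a ha).continuousAt.continuousWithinAt
  have hanti : StrictAntiOn g (Set.Ioi 0) := by
    refine strictAntiOn_of_deriv_neg (convex_Ioi 0) hcont fun a ha => ?_
    rw [interior_Ioi] at ha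
    have ha' : 0 < a := ha
    rw [(hder a ha').deriv]
    have e1 : -(2 / a) + 1 ≤ Real.exp (-(2 / a)) := Real.add_one_le_exp _
    have e2 : Real.exp (2 / a) * Real.exp (-(2 / a)) = 1 := by
      rw [← Real.exp_add]; simp
    have e3 := Real.exp_pos (2 / a)
    have e4 : Real.exp (2 / a) * (-(2 / a) + 1) ≤ 1 := by
      calc _ ≤ Real.exp (2 / a) * Real.exp (-(2 / a)) := mul_le_mul_of_nonneg_left e1 e3.le
        _ = 1 := e2
    have e5 : 0 < Real.exp (2 / a) * (2 / a ^ 2) := by positivity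
    have e6 : (a + 1) * (Real.exp (2 / a) * (-2 / a ^ 2)) =
        -(Real.exp (2 / a) * (2 / a)) - Real.exp (2 / a) * (2 / a ^ 2) := by
      field_simp
      ring
    rw [e6]
    linarith
  have h4 : 3 ≤ g 4 := by
    have := Real.quadratic_le_exp_of_nonneg (x := 2 / 4) (by norm_num)
    simp only [hg]
    linarith
  have h5 : g 5 ≤ 3 := by
    have e1 : Real.exp (2 / 5) ^ 5 = Real.exp 1 ^ 2 := by
      rw [← Real.exp_nat_mul, ← Real.exp_nat_mul]; norm_num
    have e2 : Real.exp (2 / 5) ≤ 1.5 := by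
      by_contra! hlt
      have e3 : (1.5 : ℝ) ^ 5 < Real.exp (2 / 5) ^ 5 :=
        pow_lt_pow_left₀ hlt (by norm_num) (by norm_num)
      have e4 := Real.exp_one_lt_d9
      have e5 := Real.exp_pos 1
      rw [e1] at e3
      nlinarith
    simp only [hg]
    linarith
  obtain ⟨a, ha, hga⟩ := intermediate_value_Icc' (by norm_num : (4 : ℝ) ≤ 5)
    (hcont.mono fun x hx => lt_of_lt_of_le (by norm_num) hx.1) ⟨h5, h4⟩
  have ha0 : 0 < a := lt_of_lt_of_le (by norm_num) ha.1
  exact ⟨a, ⟨ha0, hga⟩, fun b hb => hanti.injOn hb.1 ha0 (hb.2.trans hga.symm)⟩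

/-- The unique positive solution `α ≈ 4.79` of `(α + 1) (exp (2 / α) - 1) = 3`. -/
noncomputable def alphaConst : ℝ := existsUnique_alpha.choose

/-- `β = (16 π α / √3) (exp (1 / (2 α)) - 1)`. -/
noncomputable def betaConst : ℝ :=
  16 * Real.pi * alphaConst / √3 * (Real.exp (1 / (2 * alphaConst)) - 1)

/-- `ρ = 4 π α / √3`. -/
noncomputable def rhoConst : ℝ := 4 * Real.pi * alphaConst / √3

/-!
The perturbed operator `H + A`, with `A = ε V(ε)`, is brought to block diagonal form with respect to
the eigenspaces of `H`. An operator `X` is sought such that, with `T = 1 + X`,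
`(H + A) T = T (H + D)` for a bounded `D` commuting with `H`. Taking `X` off-diagonal and `D` equal
to the block diagonal part of `A T`, this is the equation `[H, X] = X D - A T` for the off-diagonal
blocks. The spectral gap `η` allows one to invert `[H, ·]` there: the inverse multiplies the block
between the eigenvalues `μ` and `ν` by `(μ - ν)⁻¹`, and is bounded by `2 / η` because
`∑ μ, (μ - ν)⁻²` is at most `2 ζ(2) / η² ≤ 4 / η²` (`sum_inv_sq_le`, `exists_schur_mul`,
`exists_inverse_commutator`). The equation becomes a fixed point equation for a contraction, with a
solution of norm at most `3 ‖A‖ / η` (`exists_block_diagonalization`).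

The operator `T⋆ T` satisfies `[H, T⋆ T] = T⋆ T D - D⋆ T⋆ T`, and for small `D` this forces `T⋆ T`
to be block diagonal (`commute_of_hasCommutator`). Hence
`T exp (-i t H) exp (-i t D) T⁻¹`, where `exp (-i t H)` is given by its eigenvalues, is a unitary
group, and it is generated by `H + A` (`IsDiagonalGroup.isUnitaryGroupGeneratedBy`); no general form
of Stone's theorem is needed.

An element `S` of the bicommutant of `H` commutes with `exp (-i t H)` and `D`, so `T S T⁻¹` is
conserved by the perturbed evolution, and `S` wanders at most by
`2 ‖S - T S T⁻¹‖ ≤ 4 ‖X‖ ‖T⁻¹‖ ‖S‖`. Under the smallness condition `ε v ρ ≤ η` this is at most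
`15 (v / η) ε ‖S‖`, and `15 < β`.
-/

/-! ### Resolutions of the identity and Schur multipliers -/

section Resolution

variable {E : Type*} [NormedAddCommGroup E] [InnerProductSpace ℂ E] [CompleteSpace E]
  {ι : Type*}

/-- A resolution of the identity: a family of mutually orthogonal orthogonal projections, some of
which may vanish, that sums strongly to the identity. -/
structure IsOrthogonalResolution (P : ι → E →L[ℂ] E) : Prop where
  isSelfAdjoint : ∀ i, IsSelfAdjoint (P i)
  mul_self : ∀ i, P i * P i = P i
  mul_of_ne : ∀ i j, i ≠ j → P i * P j = 0
  hasSum : ∀ x, HasSum (fun i => P i x) x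

namespace IsOrthogonalResolution

variable {P : ι → E →L[ℂ] E} (hP : IsOrthogonalResolution P)
include hP

theorem apply_apply_self (i : ι) (x : E) : P i (P i x) = P i x :=
  DFunLike.congr_fun (hP.mul_self i) x

theorem apply_apply_of_ne {i j : ι} (h : i ≠ j) (x : E) : P i (P j x) = 0 :=
  DFunLike.congr_fun (hP.mul_of_ne i j h) x

theorem inner_left (i : ι) (x y : E) : inner ℂ (P i x) y = inner ℂ x (P i y) := by
  have h : star (P i) = P i := hP.isSelfAdjoint i
  rw [ContinuousLinearMap.star_eq_adjoint] at h
  conv_lhs => rw [← h]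
  rw [ContinuousLinearMap.adjoint_inner_left]

theorem inner_apply_apply (i : ι) (x y : E) : inner ℂ (P i x) (P i y) = inner ℂ x (P i y) := by
  rw [hP.inner_left, hP.apply_apply_self]

theorem inner_apply_of_ne {i j : ι} (h : i ≠ j) (x y : E) : inner ℂ (P i x) (P j y) = 0 := by
  rw [hP.inner_left, hP.apply_apply_of_ne h, inner_zero_right]

/-- Parseval's identity. -/
theorem hasSum_norm_sq (x : E) : HasSum (fun i => ‖P i x‖ ^ 2) (‖x‖ ^ 2) := by
  have h1 : HasSum (fun i => inner ℂ x (P i x)) (inner ℂ x x) :=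
    ((hP.hasSum x).mapL (innerSL ℂ x))
  have h2 := h1.mapL Complex.reCLM
  have e1 : ∀ i, Complex.reCLM (inner ℂ x (P i x)) = ‖P i x‖ ^ 2 := by
    intro i
    rw [← hP.inner_apply_apply, inner_self_eq_norm_sq_to_K]
    simp [← Complex.ofReal_pow]
  have e2 : Complex.reCLM (inner ℂ x x) = ‖x‖ ^ 2 := by
    rw [inner_self_eq_norm_sq_to_K]
    simp [← Complex.ofReal_pow]
  simpa only [e1, e2] using h2

theorem sum_norm_sq_le (s : Finset ι) (x : E) : ∑ i ∈ s, ‖P i x‖ ^ 2 ≤ ‖x‖ ^ 2 :=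
  sum_le_hasSum s (fun _ _ => by positivity) (hP.hasSum_norm_sq x)

theorem ext_apply {x y : E} (h : ∀ i, P i x = P i y) : x = y :=
  (hP.hasSum x).unique (by simpa only [h] using hP.hasSum y)

theorem ext_left {A B : E →L[ℂ] E} (h : ∀ i, P i * A = P i * B) : A = B :=
  ContinuousLinearMap.ext fun x => hP.ext_apply fun i => DFunLike.congr_fun (h i) x

theorem ext_right {A B : E →L[ℂ] E} (h : ∀ i, A * P i = B * P i) : A = B :=
  ContinuousLinearMap.ext fun x =>
    ((hP.hasSum x).mapL A).unique (by
      have := (hP.hasSum x).mapL B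
      convert this using 2 with i
      exact DFunLike.congr_fun (h i) x)

/-- An operator is determined by its matrix of blocks. -/
theorem ext_block {A B : E →L[ℂ] E} (h : ∀ i j, P i * A * P j = P i * B * P j) : A = B :=
  hP.ext_left fun i => hP.ext_right fun j => h i j

/-- Dominated convergence with respect to the decomposition into components. -/
theorem tendsto_of_forall_apply {α : Type*} {l : Filter α} {u : α → E} {x y : E}
    (hbound : ∀ᶠ a in l, ∀ i, ‖P i (u a - x)‖ ≤ ‖P i y‖)
    (hlim : ∀ i, Filter.Tendsto (fun a => P i (u a)) l (nhds (P i x))) :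
    Filter.Tendsto u l (nhds x) := by
  rw [tendsto_iff_norm_sub_tendsto_zero]
  have h1 : Filter.Tendsto (fun a => ∑' i, ‖P i (u a - x)‖ ^ 2) l (nhds (∑' _ : ι, (0 : ℝ))) := by
    refine tendsto_tsum_of_dominated_convergence (hP.hasSum_norm_sq y).summable (fun i => ?_) ?_
    · have h2 : Filter.Tendsto (fun a => P i (u a) - P i x) l (nhds 0) := by
        simpa using (hlim i).sub_const (P i x)
      have h3 := (h2.norm).pow 2
      simpa [map_sub] using h3
    · filter_upwards [hbound] with a ha i
      rw [Real.norm_of_nonneg (by positivity)]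
      exact pow_le_pow_left₀ (norm_nonneg _) (ha i) 2
  simp only [(hP.hasSum_norm_sq _).tsum_eq, tsum_zero] at h1
  have h4 := (Real.continuous_sqrt.tendsto 0).comp h1
  simpa [Function.comp_def, Real.sqrt_sq (norm_nonneg _)] using h4

theorem summable_of_sum_norm_sq_le {y : ι → E} (hy : ∀ i, P i (y i) = y i) {c : ℝ}
    (h : ∀ s : Finset ι, ∑ i ∈ s, ‖y i‖ ^ 2 ≤ c) : Summable y := by
  have hO : OrthogonalFamily ℂ (fun i => (P i).range) fun i => (P i).range.subtypeₗᵢ := by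
    intro i j hij
    rintro ⟨_, a, rfl⟩ ⟨_, b, rfl⟩
    exact hP.inner_apply_of_ne hij a b
  have := (hO.summable_iff_norm_sq_summable (fun i => ⟨y i, y i, hy i⟩)).2
    (summable_of_sum_le (fun _ => by positivity) h)
  exact this

theorem apply_tsum {y : ι → E} (hy : ∀ i, P i (y i) = y i) (hs : Summable y) (i : ι) :
    P i (∑' j, y j) = y i := by
  rw [(P i).map_tsum hs, tsum_eq_single i, hy]
  intro j hj
  rw [← hy j, hP.apply_apply_of_ne hj.symm]

/-- Rows `A i` that are square summable, uniformly on the unit ball, form a bounded operator. -/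
theorem exists_of_rows (A : ι → E →L[ℂ] E) {C : ℝ} (hC : 0 ≤ C)
    (h : ∀ x (s : Finset ι), ∑ i ∈ s, ‖P i (A i x)‖ ^ 2 ≤ (C * ‖x‖) ^ 2) :
    ∃ B : E →L[ℂ] E, ‖B‖ ≤ C ∧ ∀ i, P i * B = P i * A i := by
  have hy : ∀ x i, P i (P i (A i x)) = P i (A i x) := fun x i => hP.apply_apply_self i _
  have hs : ∀ x, Summable fun i => P i (A i x) := fun x =>
    hP.summable_of_sum_norm_sq_le (hy x) (h x)
  let L : E →ₗ[ℂ] E :=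
    { toFun := fun x => ∑' i, P i (A i x)
      map_add' := fun x y => by
        rw [← (hs x).tsum_add (hs y)]
        simp only [map_add]
      map_smul' := fun c x => by
        rw [RingHom.id_apply, ← (hs x).tsum_const_smul]
        simp only [map_smul] }
  have hPL : ∀ x i, P i (L x) = P i (A i x) := fun x i => hP.apply_tsum (hy x) (hs x) i
  have hL : ∀ x, ‖L x‖ ≤ C * ‖x‖ := by
    intro x
    refine le_of_sq_le_sq ?_ (by positivity)
    rw [← (hP.hasSum_norm_sq (L x)).tsum_eq]
    simp only [hPL]
    exact Real.tsum_le_of_sum_le (fun _ => by positivity) (h x)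
  exact ⟨L.mkContinuous C hL, L.mkContinuous_norm_le hC hL, fun i =>
    ContinuousLinearMap.ext fun x => hPL x i⟩

/-- A Schur multiplier whose columns are bounded in `ℓ²` by `C` acts on bounded operators with
norm at most `C`: the `i`-th row of the product is the `i`-th row of `Y` after the diagonal
operator `∑ j, m i j • P j`, and the squared norms of the latter, applied to a vector, add up
column by column. -/
theorem exists_schur_mul (m : ι → ι → ℂ) {C : ℝ} (hC : 0 ≤ C)
    (hm : ∀ j (s : Finset ι), ∑ i ∈ s, ‖m i j‖ ^ 2 ≤ C ^ 2) (Y : E →L[ℂ] E) :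
    ∃ B : E →L[ℂ] E, ‖B‖ ≤ C * ‖Y‖ ∧ ∀ i j, P i * B * P j = m i j • (P i * Y * P j) := by
  have hm1 : ∀ i j, ‖m i j‖ ≤ C := fun i j => by
    refine le_of_sq_le_sq ?_ hC
    simpa using hm j {i}
  have hR : ∀ i, ∃ R : E →L[ℂ] E, ‖R‖ ≤ C ∧ ∀ j, P j * R = P j * (m i j • 1) := by
    intro i
    refine hP.exists_of_rows (fun j => m i j • (1 : E →L[ℂ] E)) hC fun x s => ?_
    calc ∑ j ∈ s, ‖P j ((m i j • (1 : E →L[ℂ] E)) x)‖ ^ 2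
        ≤ ∑ j ∈ s, C ^ 2 * ‖P j x‖ ^ 2 := by
          refine Finset.sum_le_sum fun j _ => ?_
          rw [← mul_pow]
          refine pow_le_pow_left₀ (norm_nonneg _) ?_ 2
          simp only [smul_apply, one_apply_eq_self, map_smul, norm_smul]
          gcongr
          exact hm1 i j
      _ ≤ (C * ‖x‖) ^ 2 := by
          rw [← Finset.mul_sum, mul_pow]
          gcongr
          exact hP.sum_norm_sq_le s x
  choose R _ hR2 using hR
  have hR3 : ∀ i j x, P j (R i x) = m i j • P j x := fun i j x => by
    have := DFunLike.congr_fun (hR2 i j) x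
    simpa using this
  obtain ⟨B, hB1, hB2⟩ := hP.exists_of_rows (fun i => Y * R i) (C := C * ‖Y‖) (by positivity) (by
    intro x s
    have hsum : HasSum (fun j => ∑ i ∈ s, ‖P j (R i x)‖ ^ 2) (∑ i ∈ s, ‖R i x‖ ^ 2) :=
      hasSum_sum fun i _ => hP.hasSum_norm_sq (R i x)
    have hcol : ∑ i ∈ s, ‖R i x‖ ^ 2 ≤ C ^ 2 * ‖x‖ ^ 2 := by
      refine hasSum_le (fun j => ?_) hsum ((hP.hasSum_norm_sq x).mul_left (C ^ 2))
      simp only [hR3, norm_smul, mul_pow]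
      rw [← Finset.sum_mul]
      gcongr
      exact hm j s
    calc ∑ i ∈ s, ‖P i ((Y * R i) x)‖ ^ 2 ≤ ∑ i ∈ s, ‖Y‖ ^ 2 * ‖R i x‖ ^ 2 := by
          refine Finset.sum_le_sum fun i _ => ?_
          rw [← mul_pow]
          refine pow_le_pow_left₀ (norm_nonneg _) ?_ 2
          have h1 : ‖P i (Y (R i x))‖ ≤ ‖Y (R i x)‖ := by
            refine le_of_sq_le_sq ?_ (norm_nonneg _)
            simpa using hP.sum_norm_sq_le {i} (Y (R i x))
          exact h1.trans (Y.le_opNorm _)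
      _ ≤ (C * ‖Y‖ * ‖x‖) ^ 2 := by
          rw [← Finset.mul_sum]
          calc _ ≤ ‖Y‖ ^ 2 * (C ^ 2 * ‖x‖ ^ 2) := by gcongr
            _ = _ := by ring)
  refine ⟨B, hB1, fun i j => ?_⟩
  rw [hB2]
  ext x
  have h2 : R i (P j x) = m i j • P j x := by
    refine hP.ext_apply fun k => ?_
    rw [hR3, map_smul]
    by_cases hk : k = j
    · rw [hk]
    · rw [hP.apply_apply_of_ne hk, smul_zero, smul_zero]
  simp [h2]

/-- The linear form of `exists_schur_mul`. -/
theorem exists_linear_schur_mul (m : ι → ι → ℂ) {C : ℝ} (hC : 0 ≤ C)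
    (hm : ∀ j (s : Finset ι), ∑ i ∈ s, ‖m i j‖ ^ 2 ≤ C ^ 2) :
    ∃ Φ : (E →L[ℂ] E) →ₗ[ℂ] (E →L[ℂ] E), (∀ Y, ‖Φ Y‖ ≤ C * ‖Y‖) ∧
      ∀ Y i j, P i * Φ Y * P j = m i j • (P i * Y * P j) := by
  choose Φ h1 h2 using hP.exists_schur_mul m hC hm
  refine ⟨{ toFun := Φ, map_add' := fun Y Z => ?_, map_smul' := fun c Y => ?_ }, h1, h2⟩
  · refine hP.ext_block fun i j => ?_
    rw [h2, mul_add, add_mul, mul_add, add_mul, h2, h2, smul_add]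
  · refine hP.ext_block fun i j => ?_
    rw [h2, RingHom.id_apply, mul_smul_comm, smul_mul_assoc, mul_smul_comm, smul_mul_assoc, h2,
      smul_comm]

end IsOrthogonalResolution

end Resolution

/-! ### Inverse of the commutator under a gap condition -/

theorem sum_inv_sq_le_of_pos {κ ν : ℝ} (hκ : 0 ≤ κ) (t : Finset ℝ)
    (hgap : ∀ a ∈ t, ∀ b ∈ t, a ≠ b → 1 ≤ κ * |a - b|) (hν : ∀ a ∈ t, 1 ≤ κ * (a - ν)) :
    ∑ a ∈ t, ((a - ν)⁻¹) ^ 2 ≤ 2 * κ ^ 2 := by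
  -- the integer parts of the rescaled distances are distinct positive integers
  have hinj : Set.InjOn (fun a => ⌊κ * (a - ν)⌋₊) (t : Set ℝ) := by
    intro a ha b hb hab
    by_contra hne
    have h1 := hgap a ha b hb hne
    have a1 := Nat.floor_le (zero_le_one.trans (hν a ha))
    have a2 := Nat.lt_floor_add_one (κ * (a - ν))
    have b1 := Nat.floor_le (zero_le_one.trans (hν b hb))
    have b2 := Nat.lt_floor_add_one (κ * (b - ν))
    simp only at hab
    rw [hab] at a1 a2
    rcases abs_cases (a - b) with ⟨h, _⟩ | ⟨h, _⟩ <;> rw [h] at h1 <;> nlinarith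
  have hterm : ∀ a ∈ t, ((a - ν)⁻¹) ^ 2 ≤ κ ^ 2 * (1 / (⌊κ * (a - ν)⌋₊ : ℝ) ^ 2) := by
    intro a ha
    have h1 := hν a ha
    have h2 : 0 < a - ν := by
      by_contra! h
      nlinarith
    have h3 : (1 : ℝ) ≤ ⌊κ * (a - ν)⌋₊ := by
      exact_mod_cast (Nat.one_le_floor_iff _).2 h1
    have h4 := Nat.floor_le (zero_le_one.trans h1)
    rw [mul_one_div, ← div_pow]
    refine pow_le_pow_left₀ (by positivity) ?_ 2
    rw [inv_eq_one_div, div_le_div_iff₀ h2 (by positivity)]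
    linarith
  calc ∑ a ∈ t, ((a - ν)⁻¹) ^ 2
      ≤ ∑ a ∈ t, κ ^ 2 * (1 / (⌊κ * (a - ν)⌋₊ : ℝ) ^ 2) := Finset.sum_le_sum hterm
    _ = κ ^ 2 * ∑ n ∈ t.image (fun a => ⌊κ * (a - ν)⌋₊), 1 / (n : ℝ) ^ 2 := by
        rw [Finset.sum_image hinj, Finset.mul_sum]
    _ ≤ κ ^ 2 * (Real.pi ^ 2 / 6) := by
        gcongr
        exact sum_le_hasSum _ (fun _ _ => by positivity) hasSum_zeta_two
    _ ≤ 2 * κ ^ 2 := by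
        have := Real.pi_lt_d2
        have := Real.pi_pos
        have : Real.pi ^ 2 / 6 ≤ 2 := by nlinarith
        nlinarith [sq_nonneg κ]

theorem sum_inv_sq_le {κ ν : ℝ} (hκ : 0 ≤ κ) (t : Finset ℝ)
    (hgap : ∀ a ∈ t, ∀ b ∈ t, a ≠ b → 1 ≤ κ * |a - b|)
    (hν : ∀ a ∈ t, a ≠ ν → 1 ≤ κ * |a - ν|) :
    ∑ a ∈ t, ((a - ν)⁻¹) ^ 2 ≤ (2 * κ) ^ 2 := by
  classical
  have h1 : ∑ a ∈ t with ν < a, ((a - ν)⁻¹) ^ 2 ≤ 2 * κ ^ 2 := by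
    refine sum_inv_sq_le_of_pos hκ _ (fun a ha b hb => ?_) fun a ha => ?_
    · exact hgap a (Finset.mem_filter.1 ha).1 b (Finset.mem_filter.1 hb).1
    · obtain ⟨h1, h2⟩ := Finset.mem_filter.1 ha
      have := hν a h1 h2.ne'
      rwa [abs_of_pos (sub_pos.2 h2)] at this
  have h2 : ∑ a ∈ t with ¬ ν < a, ((a - ν)⁻¹) ^ 2 ≤ 2 * κ ^ 2 := by
    have h3 := sum_inv_sq_le_of_pos (ν := -ν) hκ ((t.filter (· < ν)).image (- ·))
      (fun a ha b hb hab => ?_) fun a ha => ?_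
    · rw [Finset.sum_image (fun _ _ _ _ => neg_inj.1)] at h3
      refine le_trans (le_of_eq ?_) h3
      have e : ∀ a : ℝ, ((a - ν)⁻¹) ^ 2 = ((-a - -ν)⁻¹) ^ 2 := fun a => by
        rw [← neg_sub_neg, neg_sub_neg, show -a - -ν = -(a - ν) by ring, inv_neg, neg_sq]
      simp only [e]
      refine (Finset.sum_subset (fun a ha => ?_) fun a ha ha' => ?_).symm
      · obtain ⟨h1, h2⟩ := Finset.mem_filter.1 ha
        exact Finset.mem_filter.2 ⟨h1, h2.le.not_gt⟩
      · obtain ⟨h1, h2⟩ := Finset.mem_filter.1 ha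
        have : a = ν := by
          refine le_antisymm (not_lt.1 h2) (not_lt.1 fun h => ha' (Finset.mem_filter.2 ⟨h1, h⟩))
        simp [this]
    · obtain ⟨a, ha', rfl⟩ := Finset.mem_image.1 ha
      obtain ⟨b, hb', rfl⟩ := Finset.mem_image.1 hb
      have := hgap a (Finset.mem_filter.1 ha').1 b (Finset.mem_filter.1 hb').1
        fun h => hab (by rw [h])
      rwa [show -a - -b = -(a - b) by ring, abs_neg]
    · obtain ⟨a, ha', rfl⟩ := Finset.mem_image.1 ha
      obtain ⟨h1, h2⟩ := Finset.mem_filter.1 ha'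
      have := hν a h1 h2.ne
      rw [abs_of_neg (sub_neg.2 h2)] at this
      linarith
  rw [← Finset.sum_filter_add_sum_filter_not t (fun a => ν < a)]
  linarith

section Commutator

variable {E : Type*} [NormedAddCommGroup E] [InnerProductSpace ℂ E]

/-- The relation `[H, Z] = K` between bounded operators, where `H = ∑ μ, μ • P μ` may be unbounded,
read off from the blocks with respect to the resolution `P`, where it only involves bounded
operators. -/
def HasCommutator (P : ℝ → E →L[ℂ] E) (Z K : E →L[ℂ] E) : Prop :=
  ∀ μ ν, ((μ - ν : ℝ) : ℂ) • (P μ * Z * P ν) = P μ * K * P ν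

namespace HasCommutator

variable {P : ℝ → E →L[ℂ] E} {Z K Z' K' : E →L[ℂ] E}

theorem mul_left_of_commute (h : HasCommutator P Z K) (hZ' : ∀ μ, Commute (P μ) Z') :
    HasCommutator P (Z' * Z) (Z' * K) := by
  intro μ ν
  rw [← mul_assoc, (hZ' μ).eq, mul_assoc Z', mul_assoc Z', ← mul_smul_comm, h μ ν, ← mul_assoc,
    ← mul_assoc, ← mul_assoc, (hZ' μ).eq]

variable [CompleteSpace E]

theorem of_commute (hP : IsOrthogonalResolution P) (h : ∀ μ, Commute (P μ) Z) :
    HasCommutator P Z 0 := by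
  intro μ ν
  rw [mul_zero, zero_mul]
  by_cases hμν : μ = ν
  · simp [hμν]
  · rw [(h μ).eq, mul_assoc, hP.mul_of_ne μ ν hμν, mul_zero, smul_zero]

/-- The Leibniz rule. -/
theorem mul (hP : IsOrthogonalResolution P) (h : HasCommutator P Z K)
    (h' : HasCommutator P Z' K') : HasCommutator P (Z * Z') (K * Z' + Z * K') := by
  intro μ ν
  ext x
  have e1 := ((hP.hasSum (Z' (P ν x))).mapL (P μ * Z)).const_smul ((μ - ν : ℝ) : ℂ)
  have e2 := (hP.hasSum (Z' (P ν x))).mapL (P μ * K)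
  have e3 := (hP.hasSum (K' (P ν x))).mapL (P μ * Z)
  refine e1.unique ?_
  convert e2.add e3 using 1
  · funext l
    have h1 := DFunLike.congr_fun (h μ l) (Z' (P ν x))
    have h2 := DFunLike.congr_fun (h' l ν) x
    simp only [smul_apply, mul_apply_eq_comp] at h1 h2 ⊢
    rw [← h1, ← h2, map_smul, map_smul, ← add_smul]
    congr 1
    push_cast
    ring
  · simp [mul_add, add_mul]

theorem star (hP : IsOrthogonalResolution P) (h : HasCommutator P Z K) :
    HasCommutator P (star Z) (-star K) := by
  intro μ ν
  have h1 := congrArg Star.star (h ν μ)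
  simp only [star_smul, star_mul, (hP.isSelfAdjoint _).star_eq, RCLike.star_def,
    Complex.conj_ofReal] at h1
  rw [mul_neg, neg_mul, mul_assoc, mul_assoc, ← h1, ← neg_smul, ← Complex.ofReal_neg, neg_sub]

theorem _root_.IsOrthogonalResolution.commute_of_block_eq_zero (hP : IsOrthogonalResolution P)
    (h : ∀ μ ν, μ ≠ ν → P μ * Z * P ν = 0) (μ : ℝ) : Commute (P μ) Z := by
  have h1 : P μ * Z = P μ * Z * P μ := hP.ext_right fun ν => by
    by_cases hμν : μ = ν
    · rw [← hμν, mul_assoc _ (P μ), hP.mul_self]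
    · rw [h μ ν hμν, mul_assoc, hP.mul_of_ne μ ν hμν, mul_zero]
  have h2 : Z * P μ = P μ * Z * P μ := hP.ext_left fun ν => by
    by_cases hμν : ν = μ
    · rw [hμν, ← mul_assoc, ← mul_assoc, ← mul_assoc, hP.mul_self]
    · rw [← mul_assoc, h ν μ hμν, ← mul_assoc, ← mul_assoc, hP.mul_of_ne ν μ hμν, zero_mul,
        zero_mul]
  rw [Commute, SemiconjBy, h1, ← h2]

theorem eq_zero_of_commute (hP : IsOrthogonalResolution P) (h : HasCommutator P Z K)
    (hZ : ∀ μ, Commute (P μ) Z) : K = 0 := by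
  refine hP.ext_block fun μ ν => ?_
  rw [← h μ ν, of_commute hP hZ μ ν]

end HasCommutator

namespace IsOrthogonalResolution

variable [CompleteSpace E] {P : ℝ → E →L[ℂ] E} {κ : ℝ}

/-- The pinching, that is, the map to the block diagonal part, is a contraction. -/
theorem exists_pinching (hP : IsOrthogonalResolution P) :
    ∃ Δ : (E →L[ℂ] E) →ₗ[ℂ] (E →L[ℂ] E), (∀ Y, ‖Δ Y‖ ≤ ‖Y‖) ∧
      (∀ Y μ, Commute (P μ) (Δ Y)) ∧ ∀ Y μ, P μ * Δ Y * P μ = P μ * Y * P μ := by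
  classical
  obtain ⟨Δ, h1, h2⟩ := hP.exists_linear_schur_mul (fun i j => if i = j then 1 else 0)
    zero_le_one (by
      intro j s
      simp only [apply_ite norm, norm_one, norm_zero, ite_pow, one_pow, ne_eq, OfNat.ofNat_ne_zero,
        not_false_eq_true, zero_pow, Finset.sum_ite_eq']
      split_ifs <;> norm_num)
  refine ⟨Δ, fun Y => by simpa using h1 Y, fun Y => ?_, fun Y μ => by simp [h2]⟩
  exact hP.commute_of_block_eq_zero fun μ ν h => by simp [h2, h]

/-- If distinct eigenvalues have distance at least `κ⁻¹`, then `[H, Z] = Y` can be solved for the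
off-diagonal part of `Z`, with norm at most `2 κ ‖Y‖`. The diagonal blocks of the solution vanish,
as `(μ - μ)⁻¹ = 0`. -/
theorem exists_inverse_commutator (hP : IsOrthogonalResolution P) (hκ : 0 ≤ κ)
    (hgap : ∀ μ ν, P μ ≠ 0 → P ν ≠ 0 → μ ≠ ν → 1 ≤ κ * |μ - ν|) :
    ∃ Γ : (E →L[ℂ] E) →ₗ[ℂ] (E →L[ℂ] E), (∀ Y, ‖Γ Y‖ ≤ 2 * κ * ‖Y‖) ∧
      ∀ Y μ ν, P μ * Γ Y * P ν = (((μ - ν)⁻¹ : ℝ) : ℂ) • (P μ * Y * P ν) := by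
  classical
  obtain ⟨Γ, h1, h2⟩ := hP.exists_linear_schur_mul
    (fun μ ν => if P μ ≠ 0 ∧ P ν ≠ 0 then (((μ - ν)⁻¹ : ℝ) : ℂ) else 0)
    (C := 2 * κ) (by positivity) (by
      intro ν s
      by_cases hν : P ν = 0
      · simp only [hν, ne_eq, not_true_eq_false, and_false, if_false, norm_zero]
        simp only [ne_eq, OfNat.ofNat_ne_zero, not_false_eq_true, zero_pow, Finset.sum_const_zero]
        positivity
      · refine le_trans (le_of_eq ?_) (sum_inv_sq_le (ν := ν) hκ (s.filter (P · ≠ 0))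
          (fun a ha b hb => hgap a b (Finset.mem_filter.1 ha).2 (Finset.mem_filter.1 hb).2)
          fun a ha => hgap a ν (Finset.mem_filter.1 ha).2 hν)
        rw [Finset.sum_filter]
        refine Finset.sum_congr rfl fun a _ => ?_
        by_cases ha : P a = 0
        · simp [ha]
        · simp only [ne_eq, ha, hν, not_false_eq_true, and_self, if_true, Complex.norm_real,
            Real.norm_eq_abs, sq_abs])
  refine ⟨Γ, h1, fun Y μ ν => ?_⟩
  rw [h2]
  by_cases hμ : P μ = 0
  · simp [hμ]
  by_cases hν : P ν = 0
  · simp [hν]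
  simp [hμ, hν]

/-! ### Block diagonalization of the perturbed operator -/

/-- A block diagonalization of `H + A` by the invertible operator `1 + X`: formally
`(H + A) (1 + X) = (1 + X) (H + D)`, where `D` commutes with `H`. The operator `X` is the
off-diagonal solution of `[H, X] = X D - A (1 + X)` up to block diagonal terms, with `D` the
block diagonal part of `A (1 + X)`; inverting the commutator turns this quadratic equation into
the fixed point equation of a contraction of the ball of radius `r = 3 κ ‖A‖`: it maps this ball to
itself because `2 (1 + r) ^ 2 ≤ 3`. -/
theorem exists_block_diagonalization (hP : IsOrthogonalResolution P) (hκ : 0 ≤ κ)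
    (hgap : ∀ μ ν, P μ ≠ 0 → P ν ≠ 0 → μ ≠ ν → 1 ≤ κ * |μ - ν|) (A : E →L[ℂ] E)
    (hA : 34 * (κ * ‖A‖) ≤ 1) :
    ∃ X D : E →L[ℂ] E, ‖X‖ ≤ 3 * (κ * ‖A‖) ∧ ‖D‖ ≤ 2 * ‖A‖ ∧ (∀ μ, Commute (P μ) D) ∧
      HasCommutator P (1 + X) ((1 + X) * D - A * (1 + X)) := by
  obtain ⟨Δ, hΔ, hΔc, hΔd⟩ := hP.exists_pinching
  obtain ⟨Γ, hΓ, hΓd⟩ := hP.exists_inverse_commutator hκ hgap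
  have hone : ‖(1 : E →L[ℂ] E)‖ ≤ 1 := ContinuousLinearMap.norm_id_le
  set r := 3 * (κ * ‖A‖) with hr
  have hx0 : 0 ≤ κ * ‖A‖ := by positivity
  have hr0 : 0 ≤ r := by positivity
  have hr1 : r ≤ 1 / 10 := by rw [hr]; linarith
  have hAX : ∀ X : E →L[ℂ] E, ‖X‖ ≤ r → ‖A * (1 + X)‖ ≤ ‖A‖ * (1 + r) := fun X hX =>
    (norm_mul_le _ _).trans (mul_le_mul_of_nonneg_left
      ((norm_add_le _ _).trans (add_le_add hone hX)) (norm_nonneg _))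
  let F : (E →L[ℂ] E) → (E →L[ℂ] E) := fun X => Γ (X * Δ (A * (1 + X)) - A * (1 + X))
  have hF : ∀ X, ‖X‖ ≤ r → ‖F X‖ ≤ r := by
    intro X hX
    have h1 := hAX X hX
    have h2 : ‖X * Δ (A * (1 + X)) - A * (1 + X)‖ ≤ r * (‖A‖ * (1 + r)) + ‖A‖ * (1 + r) :=
      (norm_sub_le _ _).trans (add_le_add ((norm_mul_le _ _).trans
        (mul_le_mul hX ((hΔ _).trans h1) (norm_nonneg _) hr0)) h1)
    calc ‖F X‖ ≤ 2 * κ * (r * (‖A‖ * (1 + r)) + ‖A‖ * (1 + r)) :=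
          (hΓ _).trans (mul_le_mul_of_nonneg_left h2 (by positivity))
      _ = κ * ‖A‖ * (2 * (1 + r) ^ 2) := by ring
      _ ≤ κ * ‖A‖ * 3 := by
          refine mul_le_mul_of_nonneg_left ?_ hx0
          nlinarith
      _ = r := by rw [hr]; ring
  have hlip : ∀ X Y, ‖X‖ ≤ r → ‖Y‖ ≤ r → ‖F X - F Y‖ ≤ 1 / 2 * ‖X - Y‖ := by
    intro X Y hX hY
    have e : F X - F Y =
        Γ ((X - Y) * Δ (A * (1 + X)) + Y * Δ (A * (X - Y)) - A * (X - Y)) := by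
      simp only [F]
      rw [← map_sub]
      congr 1
      have : A * (X - Y) = A * (1 + X) - A * (1 + Y) := by noncomm_ring
      rw [this, map_sub]
      noncomm_ring
    have h1 : ‖(X - Y) * Δ (A * (1 + X))‖ ≤ ‖X - Y‖ * (‖A‖ * (1 + r)) :=
      (norm_mul_le _ _).trans
        (mul_le_mul_of_nonneg_left ((hΔ _).trans (hAX X hX)) (norm_nonneg _))
    have h2 : ‖A * (X - Y)‖ ≤ ‖A‖ * ‖X - Y‖ := norm_mul_le _ _
    have h3 : ‖Y * Δ (A * (X - Y))‖ ≤ r * (‖A‖ * ‖X - Y‖) :=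
      (norm_mul_le _ _).trans (mul_le_mul hY ((hΔ _).trans h2) (norm_nonneg _) hr0)
    calc ‖F X - F Y‖
        ≤ 2 * κ * (‖X - Y‖ * (‖A‖ * (1 + r)) + r * (‖A‖ * ‖X - Y‖) + ‖A‖ * ‖X - Y‖) := by
          rw [e]
          refine (hΓ _).trans (mul_le_mul_of_nonneg_left ?_ (by positivity))
          exact (norm_sub_le _ _).trans (add_le_add ((norm_add_le _ _).trans (add_le_add h1 h3)) h2)
      _ = κ * ‖A‖ * (4 * (1 + r)) * ‖X - Y‖ := by ring
      _ ≤ 1 / 2 * ‖X - Y‖ := by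
          refine mul_le_mul_of_nonneg_right ?_ (norm_nonneg _)
          nlinarith
  have hmaps : Set.MapsTo F (Metric.closedBall 0 r) (Metric.closedBall 0 r) := fun X hX => by
    rw [mem_closedBall_zero_iff] at hX ⊢
    exact hF X hX
  have hcontr : ContractingWith (1 / 2 : NNReal) (hmaps.restrict F _ _) := by
    refine ⟨by rw [← NNReal.coe_lt_coe]; norm_num, LipschitzWith.of_dist_le_mul fun X Y => ?_⟩
    rw [Subtype.dist_eq, Subtype.dist_eq, dist_eq_norm, dist_eq_norm]
    have := hlip X Y (mem_closedBall_zero_iff.1 X.2) (mem_closedBall_zero_iff.1 Y.2)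
    simpa using this
  obtain ⟨X, hX, hfix, -⟩ := hcontr.exists_fixedPoint' Metric.isClosed_closedBall.isComplete hmaps
    (Metric.mem_closedBall_self hr0) (edist_ne_top _ _)
  rw [mem_closedBall_zero_iff] at hX
  have hXfix : Γ (X * Δ (A * (1 + X)) - A * (1 + X)) = X := hfix
  refine ⟨X, Δ (A * (1 + X)), hX, ?_, hΔc _, fun μ ν => ?_⟩
  · refine (hΔ _).trans ((hAX X hX).trans ?_)
    nlinarith [norm_nonneg A]
  set D := Δ (A * (1 + X)) with hD
  have hblock := hΓd (X * D - A * (1 + X)) μ ν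
  rw [hXfix] at hblock
  by_cases hμν : μ = ν
  · subst hμν
    have h0 : P μ * X * P μ = 0 := by simpa using hblock
    have h1 : P μ * (X * D) * P μ = 0 := by
      rw [mul_assoc, mul_assoc, ← (hΔc _ μ).eq, ← mul_assoc, ← mul_assoc, h0, zero_mul]
    rw [sub_self, Complex.ofReal_zero, zero_smul, add_mul, one_mul, mul_sub, mul_add, sub_mul,
      add_mul, h1, add_zero, ← hΔd (A * (1 + X)) μ, sub_self]
  · have h1 : P μ * D * P ν = 0 := by
      rw [(hΔc _ μ).eq, mul_assoc, hP.mul_of_ne _ _ hμν, mul_zero]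
    have h2 : P μ * (1 + X) * P ν = P μ * X * P ν := by
      rw [mul_add, add_mul, mul_one, hP.mul_of_ne _ _ hμν, zero_add]
    have h3 : (((μ - ν : ℝ) : ℂ)) ≠ 0 := Complex.ofReal_ne_zero.2 (sub_ne_zero.2 hμν)
    rw [h2, hblock, Complex.ofReal_inv, smul_smul, mul_inv_cancel₀ h3, one_smul, add_mul 1 X D, one_mul,
      add_sub_assoc, mul_add (P μ) D, add_mul (P μ * D), h1, zero_add]

/-- Uniqueness for the commutator equation: a solution `G` of `[H, G] = G D - D⋆ G` with `D` small
and block diagonal is itself block diagonal. -/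
theorem commute_of_hasCommutator (hP : IsOrthogonalResolution P) (hκ : 0 ≤ κ)
    (hgap : ∀ μ ν, P μ ≠ 0 → P ν ≠ 0 → μ ≠ ν → 1 ≤ κ * |μ - ν|) {G D : E →L[ℂ] E}
    (hD : ∀ μ, Commute (P μ) D) (hDn : 8 * (κ * ‖D‖) ≤ 1)
    (hG : HasCommutator P G (G * D - star D * G)) (μ : ℝ) : Commute (P μ) G := by
  obtain ⟨Δ, hΔ, hΔc, hΔd⟩ := hP.exists_pinching
  obtain ⟨Γ, hΓ, hΓd⟩ := hP.exists_inverse_commutator hκ hgap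
  have hDs : ∀ μ, Commute (P μ) (star D) := fun μ => by
    have := (hD μ).star_star
    rwa [(hP.isSelfAdjoint μ).star_eq] at this
  set Z := G - Δ G with hZ
  -- the off-diagonal part `Z` is a fixed point of a strictly contractive linear map
  have hfix : Z = Γ (Z * D - star D * Z) := by
    refine hP.ext_block fun μ ν => ?_
    rw [hΓd]
    by_cases hμν : μ = ν
    · subst hμν
      rw [sub_self, inv_zero, Complex.ofReal_zero, zero_smul, hZ, mul_sub, sub_mul, hΔd, sub_self]
    · have h3 : (((μ - ν : ℝ) : ℂ)) ≠ 0 := Complex.ofReal_ne_zero.2 (sub_ne_zero.2 hμν)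
      have h0 : ∀ B : E →L[ℂ] E, (∀ μ, Commute (P μ) B) → P μ * B * P ν = 0 := fun B hB => by
        rw [(hB μ).eq, mul_assoc, hP.mul_of_ne _ _ hμν, mul_zero]
      have h4 : P μ * Z * P ν = P μ * G * P ν := by
        rw [hZ, mul_sub, sub_mul, h0 _ (hΔc G), sub_zero]
      have h5 : P μ * (Z * D - star D * Z) * P ν = P μ * (G * D - star D * G) * P ν := by
        have : Z * D - star D * Z = (G * D - star D * G) - (Δ G * D - star D * Δ G) := by
          rw [hZ]; noncomm_ring
        rw [this, mul_sub, sub_mul, h0 (Δ G * D - star D * Δ G) (fun μ =>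
          ((hΔc G μ).mul_right (hD μ)).sub_right ((hDs μ).mul_right (hΔc G μ))), sub_zero]
      rw [h4, h5, ← hG μ ν, Complex.ofReal_inv, smul_smul, inv_mul_cancel₀ h3, one_smul]
  have hZ0 : ‖Z‖ ≤ 1 / 2 * ‖Z‖ := by
    calc ‖Z‖ = ‖Γ (Z * D - star D * Z)‖ := by rw [← hfix]
      _ ≤ 2 * κ * (‖Z‖ * ‖D‖ + ‖D‖ * ‖Z‖) := by
          refine (hΓ _).trans (mul_le_mul_of_nonneg_left ?_ (by positivity))
          refine (norm_sub_le _ _).trans (add_le_add (norm_mul_le _ _) ?_)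
          simpa using norm_mul_le (star D) Z
      _ = 4 * (κ * ‖D‖) * ‖Z‖ := by ring
      _ ≤ 1 / 2 * ‖Z‖ := mul_le_mul_of_nonneg_right (by linarith) (norm_nonneg _)
  have hZ1 : Z = 0 := norm_le_zero_iff.1 (by linarith)
  rw [sub_eq_zero.1 hZ1]
  exact hΔc G μ

end IsOrthogonalResolution

end Commutator

/-! ### The diagonal unitary group and its bounded block diagonal perturbations -/

section Group

variable {E : Type*} [NormedAddCommGroup E] [InnerProductSpace ℂ E]

/-- The relation `φ = (H + A) ψ`, where `H = ∑ μ, μ • P μ` with its maximal domain and `A` is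
bounded, written componentwise: the existence of `φ` says that `ψ` lies in the domain of `H`. -/
def IsImageUnder (P : ℝ → E →L[ℂ] E) (A : E →L[ℂ] E) (ψ φ : E) : Prop :=
  ∀ μ : ℝ, P μ (φ - A ψ) = (μ : ℂ) • P μ ψ

/-- The unitary group `U t = ∑ μ, exp (-i t μ) • P μ`. -/
def IsDiagonalGroup (P : ℝ → E →L[ℂ] E) (U : ℝ → E →L[ℂ] E) : Prop :=
  ∀ t μ, P μ * U t = Complex.exp ((t * μ : ℝ) * -Complex.I) • P μ

theorem IsDiagonalGroup.apply {P U : ℝ → E →L[ℂ] E} (hU : IsDiagonalGroup P U) (t μ : ℝ) (x : E) :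
    P μ (U t x) = Complex.exp ((t * μ : ℝ) * -Complex.I) • P μ x :=
  DFunLike.congr_fun (hU t μ) x

variable [CompleteSpace E] {P : ℝ → E →L[ℂ] E}

/-- If `(H + A) T = T (H + D)` in the sense of commutators, then `T` maps the graph of `H + D` to
that of `H + A`. -/
theorem IsImageUnder.map (hP : IsOrthogonalResolution P) {T A D : E →L[ℂ] E}
    (hT : HasCommutator P T (T * D - A * T)) {ψ φ : E} (h : IsImageUnder P D ψ φ) :
    IsImageUnder P A (T ψ) (T φ) := by
  intro μ
  have e1 := (hP.hasSum (φ - D ψ)).mapL (P μ * T)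
  have e2 := ((hP.hasSum ψ).mapL (P μ * T)).const_smul (μ : ℂ)
  have e3 := (hP.hasSum ψ).mapL (P μ * (T * D - A * T))
  have key : (P μ * T) (φ - D ψ) = (μ : ℂ) • (P μ * T) ψ - (P μ * (T * D - A * T)) ψ := by
    refine e1.unique ?_
    convert e2.sub e3 using 1
    funext ν
    have h1 := DFunLike.congr_fun (hT μ ν) ψ
    simp only [smul_apply, mul_apply_eq_comp] at h1 ⊢
    rw [h ν, ← h1, map_smul, map_smul, ← sub_smul]
    congr 1
    push_cast
    ring
  simp only [mul_apply_eq_comp, sub_apply, map_sub] at key ⊢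
  rw [sub_eq_iff_eq_add] at key
  rw [key]
  abel

theorem IsOrthogonalResolution.exists_isDiagonalGroup (hP : IsOrthogonalResolution P) :
    ∃ U : ℝ → E →L[ℂ] E, IsDiagonalGroup P U := by
  have h1 : ∀ t μ : ℝ, ‖Complex.exp ((t * μ : ℝ) * -Complex.I)‖ = 1 := fun t μ => by
    rw [mul_neg, ← neg_mul, ← Complex.ofReal_neg, Complex.norm_exp_ofReal_mul_I]
  have : ∀ t : ℝ, ∃ B : E →L[ℂ] E, ‖B‖ ≤ 1 ∧
      ∀ μ : ℝ, P μ * B = P μ * (Complex.exp ((t * μ : ℝ) * -Complex.I) • (1 : E →L[ℂ] E)) := by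
    intro t
    refine hP.exists_of_rows
      (fun μ : ℝ => Complex.exp ((t * μ : ℝ) * -Complex.I) • (1 : E →L[ℂ] E))
      zero_le_one fun x s => ?_
    simp only [smul_apply, one_apply_eq_self, map_smul, norm_smul, h1, one_mul]
    exact hP.sum_norm_sq_le s x
  choose U _ hU using this
  exact ⟨U, fun t μ => by rw [hU, mul_smul_comm, mul_one]⟩

namespace IsDiagonalGroup

variable {U : ℝ → E →L[ℂ] E}

theorem commute (hU : IsDiagonalGroup P U) (hP : IsOrthogonalResolution P) {B : E →L[ℂ] E}
    (hB : ∀ μ, Commute (P μ) B) (t : ℝ) : Commute (U t) B := by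
  refine hP.ext_left fun μ => ?_
  rw [← mul_assoc, hU, ← mul_assoc, (hB μ).eq, mul_assoc, hU, smul_mul_assoc, mul_smul_comm,
    (hB μ).eq]

theorem commute_resolution (hU : IsDiagonalGroup P U) (hP : IsOrthogonalResolution P) (t μ : ℝ) :
    Commute (P μ) (U t) := by
  refine (hU.commute hP (fun ν => ?_) t).symm
  by_cases h : ν = μ
  · rw [h]
  · rw [Commute, SemiconjBy, hP.mul_of_ne _ _ h, hP.mul_of_ne _ _ (Ne.symm h)]

theorem map_zero (hU : IsDiagonalGroup P U) (hP : IsOrthogonalResolution P) : U 0 = 1 :=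
  hP.ext_left fun μ => by simp [hU 0 μ]

theorem map_add (hU : IsDiagonalGroup P U) (hP : IsOrthogonalResolution P) (s t : ℝ) :
    U (s + t) = U s * U t :=
  hP.ext_left fun μ => by
    rw [hU, ← mul_assoc, hU, smul_mul_assoc, hU, smul_smul, ← Complex.exp_add]
    congr 2
    push_cast
    ring

theorem star_eq (hU : IsDiagonalGroup P U) (hP : IsOrthogonalResolution P) (t : ℝ) :
    star (U t) = U (-t) :=
  hP.ext_left fun μ => by
    have h := congrArg star ((hU.commute_resolution hP t μ).eq.symm.trans (hU t μ))
    rw [star_mul, star_smul, (hP.isSelfAdjoint μ).star_eq] at h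
    rw [h, hU, RCLike.star_def, ← Complex.exp_conj]
    congr 2
    simp

theorem star_mul_self (hU : IsDiagonalGroup P U) (hP : IsOrthogonalResolution P) (t : ℝ) :
    star (U t) * U t = 1 := by
  rw [hU.star_eq hP, ← hU.map_add hP, neg_add_cancel, hU.map_zero hP]

theorem continuous_apply (hU : IsDiagonalGroup P U) (hP : IsOrthogonalResolution P) (x : E) :
    Continuous fun t => U t x := by
  rw [continuous_iff_continuousAt]
  intro t
  refine hP.tendsto_of_forall_apply (y := (2 : ℂ) • x)
    (Filter.Eventually.of_forall fun s μ => ?_) fun μ => ?_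
  · rw [_root_.map_sub, hU.apply, hU.apply, ← sub_smul, norm_smul, map_smul, norm_smul]
    gcongr
    refine (norm_sub_le _ _).trans ?_
    simp only [mul_neg, ← neg_mul, ← Complex.ofReal_neg, Complex.norm_exp_ofReal_mul_I]
    norm_num
  · simp only [hU.apply]
    exact Continuous.tendsto (by fun_prop) t

/-- The group is differentiable on the domain of `H`. -/
theorem hasDerivAt (hU : IsDiagonalGroup P U) (hP : IsOrthogonalResolution P) {ψ χ : E}
    (h : IsImageUnder P 0 ψ χ) : HasDerivAt (fun t => U t ψ) (-(Complex.I • χ)) 0 := by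
  have h0 : ∀ μ : ℝ, P μ χ = (μ : ℂ) • P μ ψ := fun μ => by simpa using h μ
  rw [hasDerivAt_iff_tendsto_slope]
  have hs : ∀ (t μ : ℝ), P μ (slope (fun t => U t ψ) 0 t) =
      ((t : ℂ)⁻¹ * (Complex.exp ((t * μ : ℝ) * -Complex.I) - 1)) • P μ ψ := fun t μ => by
    rw [slope_def_module, sub_zero, hU.map_zero hP, ← Complex.coe_smul, map_smul, _root_.map_sub,
      hU.apply, one_apply_eq_self, Complex.ofReal_inv, mul_smul, sub_smul, one_smul]
  refine hP.tendsto_of_forall_apply (y := (2 : ℂ) • χ) ?_ fun μ => ?_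
  · filter_upwards [self_mem_nhdsWithin] with t ht μ
    have ht : t ≠ 0 := ht
    rw [_root_.map_sub, hs, map_neg, map_smul, map_smul, h0, smul_smul, ← neg_smul, ← sub_smul,
      smul_smul, norm_smul, norm_smul]
    gcongr
    have h1 : ‖Complex.exp ((t * μ : ℝ) * -Complex.I) - 1‖ ≤ |t| * |μ| := by
      have := Real.norm_exp_I_mul_ofReal_sub_one_le (x := -(t * μ))
      rw [Real.norm_eq_abs, abs_neg, abs_mul] at this
      convert this using 4
      push_cast
      ring
    refine (norm_sub_le _ _).trans ?_
    rw [norm_mul, norm_inv, norm_neg, norm_mul, norm_mul, Complex.norm_I, Complex.norm_real,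
      Complex.norm_real, Real.norm_eq_abs, Real.norm_eq_abs, one_mul, Complex.norm_ofNat, two_mul]
    gcongr
    rw [inv_mul_le_iff₀ (abs_pos.2 ht)]
    exact h1
  · have hd : HasDerivAt (fun t : ℝ => Complex.exp ((t * μ : ℝ) * -Complex.I))
        (-(Complex.I * μ)) 0 := by
      have h1 : HasDerivAt (fun t : ℝ => ((t * μ : ℝ) : ℂ) * -Complex.I)
          (((1 * μ : ℝ) : ℂ) * -Complex.I) 0 :=
        (((hasDerivAt_id (0 : ℝ)).mul_const μ).ofReal_comp).mul_const _
      have h2 := h1.cexp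
      refine h2.congr_deriv ?_
      simp [mul_comm]
    rw [hasDerivAt_iff_tendsto_slope] at hd
    have h2 := hd.smul_const (P μ ψ)
    simp only [hs]
    rw [map_neg, map_smul, h0, smul_smul, ← neg_smul]
    refine h2.congr fun t => ?_
    rw [slope_def_module, sub_zero, ← Complex.coe_smul, smul_eq_mul, Complex.ofReal_inv]
    simp

/-- The generator of the product of the diagonal group with `exp (-i t D)`, where `D` is bounded
and block diagonal, is `H + D`. -/
theorem hasDerivAt_mul_exp_iff (hU : IsDiagonalGroup P U) (hP : IsOrthogonalResolution P)
    {D : E →L[ℂ] E} (hD : ∀ μ, Commute (P μ) D) (ψ φ : E) :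
    IsImageUnder P D ψ φ ↔
      HasDerivAt (fun t : ℝ => (U t * NormedSpace.exp (t • -(Complex.I • D))) ψ)
        (-(Complex.I • φ)) 0 := by
  have hK : ∀ (t μ : ℝ), Commute (P μ) (NormedSpace.exp (t • -(Complex.I • D))) := fun t μ =>
    ((((hD μ).smul_right _).neg_right).smul_right t).exp_right
  -- product rule for `exp (-i t D)` applied to a differentiable path
  have hprod : ∀ {f : ℝ → E} {f' : E}, HasDerivAt f f' 0 →
      HasDerivAt (fun t : ℝ => NormedSpace.exp (t • -(Complex.I • D)) (f t))
        (-(Complex.I • D (f 0)) + f') 0 := by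
    intro f f' hf
    have h1 := hasDerivAt_exp_smul_const (𝕂 := ℝ) (-(Complex.I • D)) 0
    have h2 := ((ContinuousLinearMap.restrictScalarsL ℂ E E ℝ ℝ).hasFDerivAt).comp_hasDerivAt
      (0 : ℝ) h1
    have h3 := h2.clm_apply hf
    refine h3.congr_deriv ?_
    simp
  constructor
  · intro h
    have h1 : HasDerivAt (fun t => U t ψ) (-(Complex.I • (φ - D ψ))) 0 :=
      hU.hasDerivAt hP (by intro μ; simpa using h μ)
    have h2 := hprod h1
    refine (h2.congr_of_eventuallyEq (Filter.Eventually.of_forall fun t => ?_)).congr_deriv ?_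
    · exact DFunLike.congr_fun (hU.commute hP (hK t) t).eq ψ
    · simp only [hU.map_zero hP, one_apply_eq_self, smul_sub]
      abel
  · intro h μ
    have h1 := (((P μ).restrictScalars ℝ).hasFDerivAt).comp_hasDerivAt (0 : ℝ) h
    have h3 : HasDerivAt (fun t : ℝ => Complex.exp ((t * μ : ℝ) * -Complex.I) • P μ ψ)
        (((1 * μ : ℝ) * -Complex.I : ℂ) • P μ ψ) 0 := by
      have h4 : HasDerivAt (fun t : ℝ => ((t * μ : ℝ) : ℂ) * -Complex.I)
          (((1 * μ : ℝ) : ℂ) * -Complex.I) 0 :=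
        (((hasDerivAt_id (0 : ℝ)).mul_const μ).ofReal_comp).mul_const _
      refine (h4.cexp.smul_const (P μ ψ)).congr_deriv ?_
      simp
    have h2 := hprod h3
    have h5 := h1.unique (h2.congr_of_eventuallyEq (Filter.Eventually.of_forall fun t => ?_))
    · have h6 : P μ (D ψ) = D (P μ ψ) := DFunLike.congr_fun (hD μ).eq ψ
      have h7 := congrArg (fun x => Complex.I • x) h5
      simp only [ContinuousLinearMap.coe_restrictScalars', map_neg, map_smul, smul_neg, smul_add,
        smul_smul, zero_mul, Complex.ofReal_zero, Complex.exp_zero, one_smul, one_mul] at h7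
      rw [_root_.map_sub, h6]
      rw [mul_neg, mul_neg, neg_smul, mul_left_comm, Complex.I_mul_I] at h7
      simp only [mul_neg, mul_one, neg_smul, neg_neg, one_smul] at h7
      rw [h7, add_sub_cancel_left]
    · have h8 := DFunLike.congr_fun (hK t μ).eq (U t ψ)
      have h9 := DFunLike.congr_fun (hU.commute hP (hK t) t).eq ψ
      simp only [mul_apply_eq_comp] at h8 h9
      simp only [Function.comp_apply, ContinuousLinearMap.coe_restrictScalars',
        mul_apply_eq_comp, h9, h8, hU.apply]

end IsDiagonalGroup

end Group

/-! ### The perturbed unitary group and its conserved quantities -/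

section Abstract

variable {E : Type*} [NormedAddCommGroup E] [InnerProductSpace ℂ E] [CompleteSpace E]
  {P : ℝ → E →L[ℂ] E} {κ : ℝ}

theorem IsUnitaryGroupGeneratedBy.norm_conj_sub_le {W : ℝ → E →L[ℂ] E} {B : E →ₗ.[ℂ] E}
    (hW : IsUnitaryGroupGeneratedBy W B) {S S' : E →L[ℂ] E} (hS' : ∀ t, Commute (W t) S')
    (t : ℝ) : ‖W (-t) * S * W t - S‖ ≤ 2 * ‖S - S'‖ := by
  have h1 : W (-t) * W t = 1 := by rw [← hW.map_add, neg_add_cancel, hW.map_zero]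
  have e : W (-t) * S * W t - S = W (-t) * (S - S') * W t - (S - S') := by
    have : W (-t) * S' * W t = S' := by rw [mul_assoc, ← (hS' t).eq, ← mul_assoc, h1, one_mul]
    rw [mul_sub, sub_mul, this]
    abel
  have hn : ‖W (-t) * (S - S') * W t‖ = ‖S - S'‖ := by
    rw [CStarRing.norm_mul_mem_unitary _ (hW.mem_unitary t),
      CStarRing.norm_mem_unitary_mul _ (hW.mem_unitary (-t))]
  rw [e, two_mul]
  exact (norm_sub_le _ _).trans (by rw [hn])

/-- If an invertible operator `T` block diagonalizes `H + A` to `H + D`, then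
`T exp (-i t H) exp (-i t D) T⁻¹` is a unitary group generated by `H + A`. The unitarity rests on
the fact that `T⋆ T` commutes with `H` and intertwines `D` with `D⋆`. -/
theorem IsDiagonalGroup.isUnitaryGroupGeneratedBy {U : ℝ → E →L[ℂ] E} (hU : IsDiagonalGroup P U)
    (hP : IsOrthogonalResolution P) (hκ : 0 ≤ κ)
    (hgap : ∀ μ ν, P μ ≠ 0 → P ν ≠ 0 → μ ≠ ν → 1 ≤ κ * |μ - ν|) {A D : E →L[ℂ] E}
    (hA : IsSelfAdjoint A) (T : (E →L[ℂ] E)ˣ) (hD : ∀ μ, Commute (P μ) D)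
    (hDn : 8 * (κ * ‖D‖) ≤ 1) (hT : HasCommutator P (T : E →L[ℂ] E) (T * D - A * T))
    {B : E →ₗ.[ℂ] E} (hB : ∀ ψ φ, (ψ, φ) ∈ B.graph ↔ IsImageUnder P A ψ φ) :
    IsUnitaryGroupGeneratedBy
      (fun t => (T : E →L[ℂ] E) * (U t * NormedSpace.exp (t • -(Complex.I • D))) *
        ((T⁻¹ : (E →L[ℂ] E)ˣ) : E →L[ℂ] E)) B := by
  let _ : NormedAlgebra ℚ (E →L[ℂ] E) := NormedAlgebra.restrictScalars ℚ ℝ _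
  set G : (E →L[ℂ] E)ˣ := star T * T with hGdef
  have hGval : (G : E →L[ℂ] E) = star (T : E →L[ℂ] E) * T := by simp [hGdef]
  have hGc : HasCommutator P (G : E →L[ℂ] E) (G * D - star D * G) := by
    have h := (hT.star hP).mul hP hT
    rw [hGval]
    convert h using 1
    rw [star_sub, star_mul, star_mul, hA.star_eq]
    noncomm_ring
  have hGP : ∀ μ, Commute (P μ) (G : E →L[ℂ] E) :=
    hP.commute_of_hasCommutator hκ hgap hD hDn hGc
  have hGD : (G : E →L[ℂ] E) * D = star D * G :=
    sub_eq_zero.1 (hGc.eq_zero_of_commute hP hGP)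
  have hGinv : ((G⁻¹ : (E →L[ℂ] E)ˣ) : E →L[ℂ] E) * star D = D * (G⁻¹ : (E →L[ℂ] E)ˣ) := by
    rw [Units.inv_mul_eq_iff_eq_mul, ← mul_assoc, hGD, Units.mul_inv_cancel_right]
  have hTinv : ((T⁻¹ : (E →L[ℂ] E)ˣ) : E →L[ℂ] E) =
      (G⁻¹ : (E →L[ℂ] E)ˣ) * star (T : E →L[ℂ] E) := by
    rw [eq_comm, Units.inv_mul_eq_iff_eq_mul, hGval, Units.mul_inv_cancel_right]
  have hT' : HasCommutator P ((T⁻¹ : (E →L[ℂ] E)ˣ) : E →L[ℂ] E)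
      ((T⁻¹ : (E →L[ℂ] E)ˣ) * A - D * (T⁻¹ : (E →L[ℂ] E)ˣ)) := by
    have h := (hT.star hP).mul_left_of_commute (Z' := ((G⁻¹ : (E →L[ℂ] E)ˣ) : E →L[ℂ] E))
      fun μ => (hGP μ).units_inv_right
    rw [hTinv]
    convert h using 1
    rw [star_sub, star_mul, star_mul, hA.star_eq, ← mul_assoc D, ← hGinv]
    noncomm_ring
  set e : ℝ → E →L[ℂ] E := fun t => NormedSpace.exp (t • -(Complex.I • D)) with he
  have heP : ∀ t μ, Commute (P μ) (e t) := fun t μ =>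
    ((((hD μ).smul_right _).neg_right).smul_right t).exp_right
  have he0 : e 0 = 1 := by simp [he]
  have headd : ∀ s t, e (s + t) = e s * e t := fun s t => by
    simp only [he]
    rw [add_smul, NormedSpace.exp_add_of_commute]
    exact ((Commute.refl _).smul_left s).smul_right t
  have hestar : ∀ t, star (e t) * G * e t = G := fun t => by
    have h1 : star (t • -(Complex.I • D)) =
        (G : E →L[ℂ] E) * ((-t) • -(Complex.I • D)) * (G⁻¹ : (E →L[ℂ] E)ˣ) := by
      rw [Units.eq_mul_inv_iff_mul_eq, star_smul, star_neg, star_smul, mul_smul_comm, mul_neg,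
        mul_smul_comm, hGD, smul_mul_assoc, neg_mul, smul_mul_assoc]
      simp
    simp only [he]
    rw [NormedSpace.star_exp, h1, NormedSpace.exp_units_conj, Units.inv_mul_cancel_right,
      mul_assoc]
    change (G : E →L[ℂ] E) * (e (-t) * e t) = G
    rw [← headd, neg_add_cancel, he0, mul_one]
  have hWadd : ∀ s t, (T : E →L[ℂ] E) * (U (s + t) * e (s + t)) * (T⁻¹ : (E →L[ℂ] E)ˣ) =
      T * (U s * e s) * (T⁻¹ : (E →L[ℂ] E)ˣ) * (T * (U t * e t) * (T⁻¹ : (E →L[ℂ] E)ˣ)) := by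
    intro s t
    have h1 := (hU.commute hP (heP s) t).eq
    rw [hU.map_add hP, headd]
    calc _ = (T : E →L[ℂ] E) * (U s * (U t * e s) * e t) * (T⁻¹ : (E →L[ℂ] E)ˣ) := by
          noncomm_ring
      _ = (T : E →L[ℂ] E) * (U s * e s) * ((T⁻¹ : (E →L[ℂ] E)ˣ) * (T : E →L[ℂ] E)) * (U t * e t) *
          (T⁻¹ : (E →L[ℂ] E)ˣ) := by
          rw [h1, Units.inv_mul]
          noncomm_ring
      _ = _ := by noncomm_ring
  have hW0 : (T : E →L[ℂ] E) * (U 0 * e 0) * (T⁻¹ : (E →L[ℂ] E)ˣ) = 1 := by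
    rw [hU.map_zero hP, he0, mul_one, mul_one, Units.mul_inv]
  refine ⟨fun t => ?_, hW0, hWadd, fun ψ => ?_, fun ψ φ => ?_⟩
  · set W := (T : E →L[ℂ] E) * (U t * e t) * (T⁻¹ : (E →L[ℂ] E)ˣ) with hW
    have hleft : star W * W = 1 := by
      have h1 : star (U t) * (G * U t) = G := by
        rw [← (hU.commute hP hGP t).eq, ← mul_assoc, hU.star_mul_self hP, one_mul]
      have h2 : star ((T⁻¹ : (E →L[ℂ] E)ˣ) : E →L[ℂ] E) * star (T : E →L[ℂ] E) = 1 := by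
        rw [← star_mul, Units.mul_inv, star_one]
      calc star W * W = star ((T⁻¹ : (E →L[ℂ] E)ˣ) : E →L[ℂ] E) *
            (star (e t) * (star (U t) * (G * U t)) * e t) * (T⁻¹ : (E →L[ℂ] E)ˣ) := by
            rw [hW, hGval]
            simp only [star_mul]
            noncomm_ring
        _ = (star ((T⁻¹ : (E →L[ℂ] E)ˣ) : E →L[ℂ] E) * star (T : E →L[ℂ] E)) *
            (T * (T⁻¹ : (E →L[ℂ] E)ˣ)) := by
            rw [h1, hestar, hGval]
            noncomm_ring
        _ = 1 := by rw [h2, Units.mul_inv, one_mul]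
    have hright : W * ((T : E →L[ℂ] E) * (U (-t) * e (-t)) * (T⁻¹ : (E →L[ℂ] E)ˣ)) = 1 := by
      rw [hW, ← hWadd, add_neg_cancel, hW0]
    refine Unitary.mem_iff.2 ⟨hleft, ?_⟩
    rwa [left_inv_eq_right_inv hleft hright]
  · have h1 : Continuous e := by
      have : Continuous fun x : E →L[ℂ] E => NormedSpace.exp x := NormedSpace.exp_continuous
      exact this.comp (by fun_prop)
    have h2 : ∀ t, ((T : E →L[ℂ] E) * (U t * e t) * (T⁻¹ : (E →L[ℂ] E)ˣ)) ψ =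
        (T : E →L[ℂ] E) (e t (U t (((T⁻¹ : (E →L[ℂ] E)ˣ) : E →L[ℂ] E) ψ))) := fun t => by
      rw [(hU.commute hP (heP t) t).eq]
      rfl
    change Continuous fun t => ((T : E →L[ℂ] E) * (U t * e t) * (T⁻¹ : (E →L[ℂ] E)ˣ)) ψ
    simp only [h2]
    exact (T : E →L[ℂ] E).continuous.comp (h1.clm_apply (hU.continuous_apply hP _))
  · rw [hB]
    have hinv : ∀ x, ((T⁻¹ : (E →L[ℂ] E)ˣ) : E →L[ℂ] E) ((T : E →L[ℂ] E) x) = x := fun x =>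
      DFunLike.congr_fun T.inv_mul x
    have hinv' : ∀ x, (T : E →L[ℂ] E) (((T⁻¹ : (E →L[ℂ] E)ˣ) : E →L[ℂ] E) x) = x := fun x =>
      DFunLike.congr_fun T.mul_inv x
    have h1 : IsImageUnder P A ψ φ ↔ IsImageUnder P D
        (((T⁻¹ : (E →L[ℂ] E)ˣ) : E →L[ℂ] E) ψ) (((T⁻¹ : (E →L[ℂ] E)ˣ) : E →L[ℂ] E) φ) := by
      refine ⟨fun h => h.map hP hT', fun h => ?_⟩
      have := h.map hP hT
      rwa [hinv', hinv'] at this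
    rw [h1, hU.hasDerivAt_mul_exp_iff hP hD]
    constructor
    · intro h
      have h2 := ((T : E →L[ℂ] E).restrictScalars ℝ).hasFDerivAt.comp_hasDerivAt (0 : ℝ) h
      simpa [Function.comp_def, hinv'] using h2
    · intro h
      have h2 := (((T⁻¹ : (E →L[ℂ] E)ˣ) : E →L[ℂ] E).restrictScalars ℝ).hasFDerivAt.comp_hasDerivAt
        (0 : ℝ) h
      simpa [Function.comp_def, hinv] using h2

/-- The perturbed operator `H + A` generates a unitary group, and every operator `S` in the
bicommutant of the resolution stays close to its initial value: `T S T⁻¹` is a conserved quantity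
that is close to `S`, where `T` is the block diagonalizing operator. -/
theorem IsOrthogonalResolution.exists_group_norm_conj_sub_le (hP : IsOrthogonalResolution P)
    (hκ : 0 ≤ κ) (hgap : ∀ μ ν, P μ ≠ 0 → P ν ≠ 0 → μ ≠ ν → 1 ≤ κ * |μ - ν|) {A : E →L[ℂ] E}
    (hA : IsSelfAdjoint A) (hAn : 34 * (κ * ‖A‖) ≤ 1) {B : E →ₗ.[ℂ] E}
    (hB : ∀ ψ φ, (ψ, φ) ∈ B.graph ↔ IsImageUnder P A ψ φ) :
    ∃ W : ℝ → E →L[ℂ] E, IsUnitaryGroupGeneratedBy W B ∧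
      ∀ S : E →L[ℂ] E, (∀ Z, (∀ μ, Commute (P μ) Z) → Commute S Z) →
        ∀ t, ‖W (-t) * S * W t - S‖ ≤ 15 * (κ * ‖A‖) * ‖S‖ := by
  obtain ⟨X, D, hX, hDn, hD, hT⟩ := hP.exists_block_diagonalization hκ hgap A hAn
  obtain ⟨U, hU⟩ := hP.exists_isDiagonalGroup
  have hX1 : ‖X‖ ≤ 1 / 10 := by linarith
  have hx0 : 0 ≤ κ * ‖A‖ := by positivity
  let T : (E →L[ℂ] E)ˣ := Units.oneSub (-X) (by rw [norm_neg]; linarith)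
  have hTval : (T : E →L[ℂ] E) = 1 + X := by simp [T]
  have hκD : 8 * (κ * ‖D‖) ≤ 1 := by
    have := mul_le_mul_of_nonneg_left hDn hκ
    linarith
  have hW := hU.isUnitaryGroupGeneratedBy hP hκ hgap hA T hD hκD (by rw [hTval]; exact hT) hB
  refine ⟨_, hW, fun S hS t => ?_⟩
  have hS' : ∀ t, Commute
      ((T : E →L[ℂ] E) * (U t * NormedSpace.exp (t • -(Complex.I • D))) * (T⁻¹ : (E →L[ℂ] E)ˣ))
      ((T : E →L[ℂ] E) * S * (T⁻¹ : (E →L[ℂ] E)ˣ)) := fun t => by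
    have h1 : Commute (U t * NormedSpace.exp (t • -(Complex.I • D))) S :=
      (hS _ fun μ => (hU.commute_resolution hP t μ).mul_right
        ((((hD μ).smul_right _).neg_right).smul_right t).exp_right).symm
    generalize U t * NormedSpace.exp (t • -(Complex.I • D)) = M at h1
    rw [Commute, SemiconjBy, ← mul_assoc, ← mul_assoc, ← mul_assoc, ← mul_assoc,
      Units.inv_mul_cancel_right, Units.inv_mul_cancel_right, mul_assoc _ M S, h1.eq,
      ← mul_assoc _ S]
  refine (hW.norm_conj_sub_le hS' t).trans ?_
  -- `S - T S T⁻¹ = (S X - X S) T⁻¹`, where the inverse is bounded by `(1 - ‖X‖)⁻¹`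
  have e : S - T * S * (T⁻¹ : (E →L[ℂ] E)ˣ) = (S * X - X * S) * (T⁻¹ : (E →L[ℂ] E)ˣ) := by
    rw [Units.eq_mul_inv_iff_mul_eq, sub_mul, Units.inv_mul_cancel_right, hTval]
    noncomm_ring
  have hinv : ‖((T⁻¹ : (E →L[ℂ] E)ˣ) : E →L[ℂ] E)‖ ≤ 10 / 9 := by
    set R := ((T⁻¹ : (E →L[ℂ] E)ˣ) : E →L[ℂ] E) with hR
    have h1 : R = 1 - X * R := by
      have : (T : E →L[ℂ] E) * R = 1 := T.mul_inv
      rw [hTval, add_mul, one_mul] at this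
      exact eq_sub_of_add_eq this
    have hone : ‖(1 : E →L[ℂ] E)‖ ≤ 1 := ContinuousLinearMap.norm_id_le
    have h2 : ‖R‖ ≤ 1 + ‖X‖ * ‖R‖ := by
      conv_lhs => rw [h1]
      exact (norm_sub_le _ _).trans (add_le_add hone (norm_mul_le _ _))
    nlinarith [norm_nonneg R]
  have hcomm : ‖S * X - X * S‖ ≤ 2 * (3 * (κ * ‖A‖)) * ‖S‖ := by
    calc ‖S * X - X * S‖ ≤ ‖S‖ * ‖X‖ + ‖X‖ * ‖S‖ :=
          (norm_sub_le _ _).trans (add_le_add (norm_mul_le _ _) (norm_mul_le _ _))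
      _ = 2 * ‖X‖ * ‖S‖ := by ring
      _ ≤ _ := by gcongr
  rw [e]
  calc 2 * ‖(S * X - X * S) * (T⁻¹ : (E →L[ℂ] E)ˣ)‖
      ≤ 2 * (2 * (3 * (κ * ‖A‖)) * ‖S‖ * (10 / 9)) := by
        gcongr
        exact (norm_mul_le _ _).trans (by gcongr)
    _ ≤ 15 * (κ * ‖A‖) * ‖S‖ := by
        have : 0 ≤ κ * ‖A‖ * ‖S‖ := by positivity
        linarith

end Abstract

/-! ### Eigenprojections of a self-adjoint operator with pure point spectrum -/

section Operator

variable {E : Type*} [NormedAddCommGroup E] [InnerProductSpace ℂ E]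
  {H : E →ₗ.[ℂ] E}

theorem mem_graph_perturbed_iff (V : ℝ → E →L[ℂ] E) (ε : ℝ) (ψ φ : E) :
    (ψ, φ) ∈ (perturbed H V ε).graph ↔ (ψ, φ - ((ε : ℂ) • V ε) ψ) ∈ H.graph := by
  rw [LinearPMap.mem_graph_iff, LinearPMap.mem_graph_iff]
  constructor
  · rintro ⟨y, rfl, rfl⟩
    exact ⟨y, rfl, (add_sub_cancel_left _ _).symm⟩
  · rintro ⟨y, rfl, h⟩
    refine ⟨y, rfl, ?_⟩
    have h' : H y = φ - ((ε : ℂ) • V ε) y := h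
    change ((ε : ℂ) • V ε) y + H y = φ
    rw [h', add_sub_cancel]

variable [CompleteSpace E]

theorem mem_graph_iff_of_isSelfAdjoint (hH : IsSelfAdjoint H) (y z : E) :
    (y, z) ∈ H.graph ↔ ∀ a b, (a, b) ∈ H.graph → inner ℂ b y = inner ℂ a z := by
  have h : H.adjoint.graph = H.graph := by rw [LinearPMap.isSelfAdjoint_def.1 hH]
  rw [LinearPMap.adjoint_graph_eq_graph_adjoint hH.dense_domain] at h
  conv_lhs => rw [← h, Submodule.mem_adjoint_iff]
  simp only [sub_eq_zero]

theorem isClosed_opEigenspace (hH : IsSelfAdjoint H) (μ : ℝ) :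
    IsClosed (opEigenspace H μ : Set E) :=
  hH.isClosed.preimage (f := fun ψ : E => (ψ, (μ : ℂ) • ψ)) (by fun_prop)

theorem inner_opEigenspace_graph (hH : IsSelfAdjoint H) {μ : ℝ} {e ψ φ : E}
    (he : e ∈ opEigenspace H μ) (h : (ψ, φ) ∈ H.graph) :
    inner ℂ e φ = (μ : ℂ) * inner ℂ e ψ := by
  have h1 : inner ℂ ((μ : ℂ) • e) ψ = inner ℂ e φ :=
    (mem_graph_iff_of_isSelfAdjoint hH ψ φ).1 h e _ he
  rw [← h1, inner_smul_left, Complex.conj_ofReal]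

theorem topologicalClosure_iSup_opEigenspace_singleton (hH : IsSelfAdjoint H) (μ : ℝ) :
    (⨆ ν ∈ ({μ} : Set ℝ), opEigenspace H ν).topologicalClosure = opEigenspace H μ := by
  rw [iSup_singleton]
  exact (isClosed_opEigenspace hH μ).submodule_topologicalClosure_eq

theorem pointSpectralProjection_singleton_mem (hH : IsSelfAdjoint H) (μ : ℝ) (x : E) :
    pointSpectralProjection H {μ} x ∈ opEigenspace H μ := by
  have h := Submodule.starProjection_apply_mem
    (⨆ ν ∈ ({μ} : Set ℝ), opEigenspace H ν).topologicalClosure x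
  exact (topologicalClosure_iSup_opEigenspace_singleton hH μ).le h

theorem pointSpectralProjection_eq_self {Ω : Set ℝ} {μ : ℝ} (hμ : μ ∈ Ω) {x : E}
    (hx : x ∈ opEigenspace H μ) : pointSpectralProjection H Ω x = x := by
  refine Submodule.starProjection_eq_self_iff.2 (Submodule.le_topologicalClosure _ ?_)
  exact (le_iSup₂ (f := fun ν (_ : ν ∈ Ω) => opEigenspace H ν) μ hμ) hx

theorem pointSpectralProjection_eq_zero {Ω : Set ℝ} {x : E}
    (hx : ∀ μ ∈ Ω, ∀ e ∈ opEigenspace H μ, inner ℂ e x = 0) :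
    pointSpectralProjection H Ω x = 0 := by
  refine (Submodule.starProjection_apply_eq_zero_iff _).2 ?_
  rw [Submodule.orthogonal_closure, ← Submodule.iInf_orthogonal, Submodule.mem_iInf]
  intro μ
  by_cases hμ : μ ∈ Ω
  · simpa only [hμ, iSup_pos] using (Submodule.mem_orthogonal _ _).2 (hx μ hμ)
  · simp [hμ]

theorem inner_opEigenspace_of_ne (hH : IsSelfAdjoint H) {μ ν : ℝ} (h : μ ≠ ν) {e f : E}
    (he : e ∈ opEigenspace H μ) (hf : f ∈ opEigenspace H ν) : inner ℂ e f = 0 := by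
  have h1 : inner ℂ e ((ν : ℂ) • f) = (μ : ℂ) * inner ℂ e f :=
    inner_opEigenspace_graph hH he hf
  rw [inner_smul_right, ← sub_eq_zero, ← sub_mul, mul_eq_zero] at h1
  refine h1.resolve_left fun h2 => h ?_
  exact_mod_cast (sub_eq_zero.1 h2).symm

/-- The eigenprojections of a self-adjoint operator with pure point spectrum resolve the
identity. -/
theorem isOrthogonalResolution_pointSpectralProjection (hH : IsSelfAdjoint H)
    (hpp : HasPurePointSpectrum H) :
    IsOrthogonalResolution fun μ : ℝ => pointSpectralProjection H {μ} where
  isSelfAdjoint μ := isSelfAdjoint_starProjection _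
  mul_self μ := by
    ext x
    exact pointSpectralProjection_eq_self (Set.mem_singleton μ)
      (pointSpectralProjection_singleton_mem hH μ x)
  mul_of_ne μ ν h := by
    ext x
    refine pointSpectralProjection_eq_zero fun l hl e he => ?_
    rw [Set.mem_singleton_iff.1 hl] at he
    exact inner_opEigenspace_of_ne hH h he (pointSpectralProjection_singleton_mem hH ν x)
  hasSum x := by
    have hcomplete : ∀ μ, CompleteSpace (opEigenspace H μ) := fun μ =>
      (isClosed_opEigenspace hH μ).completeSpace_coe
    have hsum : IsHilbertSum ℂ (fun μ => opEigenspace H μ)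
        fun μ => (opEigenspace H μ).subtypeₗᵢ :=
      IsHilbertSum.mkInternal _
        (fun μ ν h e f => inner_opEigenspace_of_ne hH h e.2 f.2) hpp.ge
    have h1 := hsum.hasSum_linearIsometryEquiv_symm (hsum.linearIsometryEquiv x)
    rw [LinearIsometryEquiv.symm_apply_apply] at h1
    convert h1 using 2 with μ
    refine ((h1.mapL (pointSpectralProjection H {μ})).unique ?_)
    convert hasSum_single μ fun ν hν => ?_ using 1
    · exact (pointSpectralProjection_eq_self (Set.mem_singleton μ)
        (hsum.linearIsometryEquiv x μ).2).symm
    · refine pointSpectralProjection_eq_zero fun l hl e he => ?_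
      rw [Set.mem_singleton_iff.1 hl] at he
      exact inner_opEigenspace_of_ne hH hν.symm he (hsum.linearIsometryEquiv x ν).2

theorem pointSpectralProjection_singleton_ne_zero (hH : IsSelfAdjoint H) {μ : ℝ}
    (h : pointSpectralProjection H {μ} ≠ 0) : μ ∈ pointSpectrum H := by
  intro h0
  refine h (ContinuousLinearMap.ext fun x => ?_)
  have := pointSpectralProjection_singleton_mem hH μ x
  rwa [h0, Submodule.mem_bot] at this

/-- A self-adjoint operator with pure point spectrum acts on its maximal domain as multiplication
by the eigenvalues. -/
theorem mem_graph_iff_pointSpectralProjection (hH : IsSelfAdjoint H)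
    (hpp : HasPurePointSpectrum H) (ψ φ : E) :
    (ψ, φ) ∈ H.graph ↔
      ∀ μ : ℝ, pointSpectralProjection H {μ} φ = (μ : ℂ) • pointSpectralProjection H {μ} ψ := by
  have hP := isOrthogonalResolution_pointSpectralProjection hH hpp
  have hmp : ∀ ψ φ, (ψ, φ) ∈ H.graph → ∀ μ : ℝ,
      pointSpectralProjection H {μ} φ = (μ : ℂ) • pointSpectralProjection H {μ} ψ := by
    intro ψ φ h μ
    rw [← sub_eq_zero, ← map_smul, ← map_sub]
    refine pointSpectralProjection_eq_zero fun l hl e he => ?_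
    rw [Set.mem_singleton_iff.1 hl] at he
    rw [inner_sub_right, inner_smul_right, inner_opEigenspace_graph hH he h, sub_self]
  refine ⟨hmp ψ φ, fun h => ?_⟩
  refine (mem_graph_iff_of_isSelfAdjoint hH ψ φ).2 fun a b hab => ?_
  refine ((hP.hasSum ψ).mapL (innerSL ℂ b)).unique (a₂ := innerSL ℂ a φ) ?_
  convert (hP.hasSum φ).mapL (innerSL ℂ a) using 2 with μ
  simp only [innerSL_apply_apply]
  rw [h μ, inner_smul_right, ← hP.inner_left, ← hP.inner_left, hmp a b hab, inner_smul_left,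
    Complex.conj_ofReal]

theorem mem_opCommutant_of_commute (hH : IsSelfAdjoint H) (hpp : HasPurePointSpectrum H)
    {Z : E →L[ℂ] E} (hZ : ∀ μ : ℝ, Commute (pointSpectralProjection H {μ}) Z) :
    Z ∈ opCommutant H := by
  have hP := isOrthogonalResolution_pointSpectralProjection hH hpp
  intro Ω _
  refine hP.ext_right fun μ => ?_
  have h : pointSpectralProjection H Ω * pointSpectralProjection H {μ} =
      pointSpectralProjection H {μ} ∨
      pointSpectralProjection H Ω * pointSpectralProjection H {μ} = 0 := by
    by_cases hμ : μ ∈ Ω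
    · left
      ext x
      exact pointSpectralProjection_eq_self hμ (pointSpectralProjection_singleton_mem hH μ x)
    · right
      ext x
      refine pointSpectralProjection_eq_zero fun l hl e he => ?_
      have hne : l ≠ μ := fun h => hμ (by rwa [← h])
      exact inner_opEigenspace_of_ne hH hne he
        (pointSpectralProjection_singleton_mem hH μ x)
  rw [mul_assoc, mul_assoc, ← (hZ μ).eq, ← mul_assoc (pointSpectralProjection H Ω)]
  rcases h with h | h <;> rw [h]
  · exact (hZ μ).eq.symm
  · rw [mul_zero, zero_mul]

/-- A bounded self-adjoint perturbation of a self-adjoint operator is self-adjoint. -/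
theorem isSelfAdjoint_perturbed (hH : IsSelfAdjoint H) {V : ℝ → E →L[ℂ] E} {ε : ℝ}
    (hV : IsSelfAdjoint (V ε)) : IsSelfAdjoint (perturbed H V ε) := by
  have hA : IsSelfAdjoint ((ε : ℂ) • V ε) :=
    IsSelfAdjoint.smul (by simp [IsSelfAdjoint]) hV
  have hA' : ∀ x y, inner ℂ (((ε : ℂ) • V ε) x) y = inner ℂ x (((ε : ℂ) • V ε) y) := fun x y =>
    hA.isSymmetric x y
  have hdense : Dense ((perturbed H V ε).domain : Set E) := hH.dense_domain
  rw [LinearPMap.isSelfAdjoint_def]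
  refine LinearPMap.eq_of_eq_graph ?_
  rw [LinearPMap.adjoint_graph_eq_graph_adjoint hdense]
  ext ⟨y, z⟩
  rw [Submodule.mem_adjoint_iff, mem_graph_perturbed_iff, mem_graph_iff_of_isSelfAdjoint hH]
  constructor
  · intro h a b hab
    have h1 := h a (b + ((ε : ℂ) • V ε) a)
      ((mem_graph_perturbed_iff V ε _ _).2 (by rwa [add_sub_cancel_right]))
    rw [inner_add_left, hA', sub_eq_zero] at h1
    rw [inner_sub_right, ← h1, add_sub_cancel_right]
  · intro h a b hab
    have h1 := h a _ ((mem_graph_perturbed_iff V ε _ _).1 hab)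
    rw [inner_sub_left, inner_sub_right, hA'] at h1
    rw [sub_eq_zero]
    exact sub_left_injective h1

end Operator

/-! ### Numerical values of the constants -/

theorem alphaConst_mem_Ioo : alphaConst ∈ Set.Ioo (4.7915 : ℝ) 4.7925 := by
  set g : ℝ → ℝ := fun a => (a + 1) * (Real.exp (2 / a) - 1) with hg
  have hcont : ContinuousOn g (Set.Icc 4.7915 4.7925) := by
    refine ContinuousOn.mul (by fun_prop) (ContinuousOn.sub (ContinuousOn.rexp ?_) (by fun_prop))
    exact continuousOn_const.div continuousOn_id fun x hx =>
      (lt_of_lt_of_le (by norm_num) hx.1).ne'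
  have h1 : 3 < g 4.7915 := by
    have h := Real.sum_le_exp_of_nonneg (x := 2 / 4.7915) (by norm_num) 7
    simp only [Finset.sum_range_succ, Finset.sum_range_zero, Nat.factorial] at h
    have h2 : (3 : ℝ) / (4.7915 + 1) + 1 < Real.exp (2 / 4.7915) :=
      lt_of_lt_of_le (by norm_num) h
    simp only [hg]
    norm_num at h2 ⊢
    linarith
  have h2 : g 4.7925 < 3 := by
    have h := Real.exp_bound' (x := 2 / 4.7925) (by norm_num) (by norm_num) (n := 7) (by norm_num)
    simp only [Finset.sum_range_succ, Finset.sum_range_zero, Nat.factorial] at h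
    have h2 : Real.exp (2 / 4.7925) < (3 : ℝ) / (4.7925 + 1) + 1 :=
      lt_of_le_of_lt h (by norm_num)
    simp only [hg]
    norm_num at h2 ⊢
    linarith
  obtain ⟨a, ha, hga⟩ := intermediate_value_Ioo' (by norm_num : (4.7915 : ℝ) ≤ 4.7925) hcont
    ⟨h2, h1⟩
  have ha0 : 0 < a := lt_trans (by norm_num) ha.1
  have : alphaConst = a :=
    existsUnique_alpha.unique existsUnique_alpha.choose_spec.1 ⟨ha0, hga⟩
  rwa [this]

theorem rhoConst_mem_Ioo : rhoConst ∈ Set.Ioo (34.75 : ℝ) 34.772 := by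
  obtain ⟨h1, h2⟩ := alphaConst_mem_Ioo
  have p1 := Real.pi_gt_d4
  have p2 := Real.pi_lt_d4
  have s1 : (1.73205 : ℝ) < √3 := Real.lt_sqrt_of_sq_lt (by norm_num)
  have s2 : √3 < (1.73206 : ℝ) := (Real.sqrt_lt' (by norm_num)).2 (by norm_num)
  have s0 : (0 : ℝ) < √3 := by positivity
  constructor
  · rw [rhoConst, lt_div_iff₀ s0]
    nlinarith
  · rw [rhoConst, div_lt_iff₀ s0]
    nlinarith

theorem betaConst_mem_Ioo : betaConst ∈ Set.Ioo (15.25 : ℝ) 15.3 := by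
  obtain ⟨h1, h2⟩ := alphaConst_mem_Ioo
  obtain ⟨r1, r2⟩ := rhoConst_mem_Ioo
  have e : betaConst = 4 * rhoConst * (Real.exp (1 / (2 * alphaConst)) - 1) := by
    rw [betaConst, rhoConst]
    ring
  have hu1 : (1 : ℝ) / (2 * 4.7925) ≤ 1 / (2 * alphaConst) := by
    apply one_div_le_one_div_of_le <;> linarith
  have hu2 : 1 / (2 * alphaConst) ≤ (1 : ℝ) / (2 * 4.7915) := by
    apply one_div_le_one_div_of_le <;> linarith
  have hl : (0.10975 : ℝ) < Real.exp (1 / (2 * alphaConst)) - 1 := by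
    have h := Real.sum_le_exp_of_nonneg (x := 1 / (2 * 4.7925)) (by norm_num) 4
    simp only [Finset.sum_range_succ, Finset.sum_range_zero, Nat.factorial] at h
    have h3 : (1.10975 : ℝ) < Real.exp (1 / (2 * 4.7925)) := lt_of_lt_of_le (by norm_num) h
    have := Real.exp_le_exp.2 hu1
    linarith
  have hu : Real.exp (1 / (2 * alphaConst)) - 1 < (0.109993 : ℝ) := by
    have h := Real.exp_bound' (x := 1 / (2 * 4.7915)) (by norm_num) (by norm_num) (n := 4)
      (by norm_num)
    simp only [Finset.sum_range_succ, Finset.sum_range_zero, Nat.factorial] at h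
    have h3 : Real.exp (1 / (2 * 4.7915)) < (1.109993 : ℝ) := lt_of_le_of_lt h (by norm_num)
    have := Real.exp_le_exp.2 hu2
    linarith
  rw [e]
  constructor <;> nlinarith

/-! ### Bound on the wandering range -/

theorem mainTheorem1
    {E : Type*} [NormedAddCommGroup E] [InnerProductSpace ℂ E] [CompleteSpace E]
    [TopologicalSpace.SeparableSpace E]
    (H : E →ₗ.[ℂ] E) (hH : IsSelfAdjoint H) (hpp : HasPurePointSpectrum H)
    (η : ℝ≥0∞) (hη : η = minimalSpectralGap H) (hη_pos : 0 < η)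
    (V : ℝ → E →L[ℂ] E) (hV : ∀ ε ∈ Set.Icc (0 : ℝ) 1, IsSelfAdjoint (V ε))
    (v : ℝ≥0∞) (hv : v = ⨆ ε ∈ Set.Icc (0 : ℝ) 1, ‖V ε‖ₑ) (hv_fin : v < ∞) :
    (15.25 < betaConst ∧ betaConst < 15.3 ∧ 34.75 < rhoConst ∧ rhoConst < 34.8) ∧
    ∀ S ∈ opBicommutant H, ∀ ε ∈ Set.Icc (0 : ℝ) 1,
      ENNReal.ofReal ε ≤ η / (v * ENNReal.ofReal rhoConst) →
      IsUnitaryGroupGeneratedBy (unitaryGroup (perturbed H V ε)) (perturbed H V ε) ∧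
      wanderingRange (perturbed H V ε) S ≤
        ENNReal.ofReal betaConst * (v / η) * ‖S‖ₑ * ENNReal.ofReal ε := by
  obtain ⟨b1, b2⟩ := betaConst_mem_Ioo
  obtain ⟨r1, r2⟩ := rhoConst_mem_Ioo
  refine ⟨⟨b1, b2, r1, r2.trans (by norm_num)⟩, fun S hS ε hε hsmall => ?_⟩
  have hP := isOrthogonalResolution_pointSpectralProjection hH hpp
  have hηinv : η⁻¹ ≠ ∞ := ENNReal.inv_ne_top.2 hη_pos.ne'
  -- `κ = 1 / η`, which is `0` when there are no two distinct eigenvalues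
  set κ : ℝ := (η⁻¹).toReal with hκ
  have hκ0 : 0 ≤ κ := ENNReal.toReal_nonneg
  have hgap : ∀ μ ν : ℝ, pointSpectralProjection H {μ} ≠ 0 → pointSpectralProjection H {ν} ≠ 0 →
      μ ≠ ν → 1 ≤ κ * |μ - ν| := by
    intro μ ν hμ hν hne
    have h1 : η ≤ edist μ ν := hη ▸ Set.einfsep_le_edist_of_mem
      (pointSpectralProjection_singleton_ne_zero hH hμ)
      (pointSpectralProjection_singleton_ne_zero hH hν) hne
    have h2 : 1 ≤ η⁻¹ * edist μ ν := by
      rw [← ENNReal.inv_mul_cancel hη_pos.ne' (ne_top_of_le_ne_top (edist_ne_top μ ν) h1)]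
      gcongr
    have h3 := ENNReal.toReal_mono (ENNReal.mul_ne_top hηinv (edist_ne_top μ ν)) h2
    rwa [ENNReal.toReal_one, ENNReal.toReal_mul, ← dist_edist, Real.dist_eq] at h3
  have hVn : ‖V ε‖ ≤ v.toReal := by
    have h1 : ‖V ε‖ₑ ≤ v := hv ▸ le_iSup₂ (f := fun ε (_ : ε ∈ Set.Icc (0 : ℝ) 1) => ‖V ε‖ₑ) ε hε
    simpa using ENNReal.toReal_mono hv_fin.ne h1
  have hAn : ‖(ε : ℂ) • V ε‖ ≤ ε * v.toReal := by
    rw [norm_smul, Complex.norm_real, Real.norm_of_nonneg hε.1]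
    exact mul_le_mul_of_nonneg_left hVn hε.1
  have hcond : 34 * (κ * ‖(ε : ℂ) • V ε‖) ≤ 1 := by
    have h1 : ENNReal.ofReal ε * (v * ENNReal.ofReal rhoConst) / η ≤ 1 :=
      ENNReal.div_le_of_le_mul (by simpa using ENNReal.mul_le_of_le_div hsmall)
    have h2 := ENNReal.toReal_mono ENNReal.one_ne_top h1
    rw [div_eq_mul_inv, ENNReal.toReal_mul, ENNReal.toReal_mul, ENNReal.toReal_mul,
      ENNReal.toReal_ofReal hε.1, ENNReal.toReal_ofReal (by linarith), ENNReal.toReal_one] at h2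
    have h3 : κ * ‖(ε : ℂ) • V ε‖ ≤ κ * (ε * v.toReal) := mul_le_mul_of_nonneg_left hAn hκ0
    have h4 : 0 ≤ κ * (ε * v.toReal) := by
      have := hε.1
      positivity
    nlinarith
  have hB : ∀ ψ φ, (ψ, φ) ∈ (perturbed H V ε).graph ↔
      IsImageUnder (fun μ : ℝ => pointSpectralProjection H {μ}) ((ε : ℂ) • V ε) ψ φ := fun ψ φ => by
    rw [mem_graph_perturbed_iff, mem_graph_iff_pointSpectralProjection hH hpp]
    rfl
  have hA : IsSelfAdjoint ((ε : ℂ) • V ε) :=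
    IsSelfAdjoint.smul (by simp [IsSelfAdjoint]) (hV ε hε)
  obtain ⟨W, hW, hWS⟩ := hP.exists_group_norm_conj_sub_le hκ0 hgap hA hcond hB
  have hex : ∃ U : ℝ → E →L[ℂ] E, IsUnitaryGroupGeneratedBy U (perturbed H V ε) := ⟨W, hW⟩
  have hgroup : IsUnitaryGroupGeneratedBy (unitaryGroup (perturbed H V ε)) (perturbed H V ε) := by
    rw [unitaryGroup, dif_pos hex]
    exact hex.choose_spec
  refine ⟨hgroup, iSup_le fun t => ?_⟩
  rw [hgroup.unique (isSelfAdjoint_perturbed hH (hV ε hε)) hW]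
  have hbound := hWS S (fun Z hZ => hS Z (mem_opCommutant_of_commute hH hpp hZ)) t
  have hrhs : ENNReal.ofReal betaConst * (v / η) * ‖S‖ₑ * ENNReal.ofReal ε =
      ENNReal.ofReal (betaConst * (v.toReal * κ) * ‖S‖ * ε) := by
    have hb : 0 ≤ betaConst := by linarith
    rw [ENNReal.ofReal_mul (by positivity), ENNReal.ofReal_mul (by positivity),
      ENNReal.ofReal_mul hb, ENNReal.ofReal_mul (by positivity), ENNReal.ofReal_toReal hv_fin.ne,
      ENNReal.ofReal_toReal hηinv, ofReal_norm, div_eq_mul_inv]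
  rw [hrhs, ← ofReal_norm]
  refine ENNReal.ofReal_le_ofReal (hbound.trans ?_)
  calc 15 * (κ * ‖(ε : ℂ) • V ε‖) * ‖S‖ ≤ betaConst * (κ * (ε * v.toReal)) * ‖S‖ := by
        have := hε.1
        gcongr
        linarith
    _ = _ := by ring
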